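/- Let $\mathbb N=\{1,2,\dots\}$. For $n\ge 2$ let $X_n=\{1,\dots,n\}\times\mathbb N$ and, for $k\in\{2,\dots,n\}$, let $g_k$ be the permutation of $X_n$ with $(1,m)\mapsto(1,m+1)$ for $m\ge1$, $(k,1)\mapsto(1,1)$, $(k,m)\mapsto(k,m-1)$ for $m\ge 2$, and fixing all other points. For $n\ge3$ the Houghton group is $H_n=\langle g_2,\dots,g_n\rangle\le\mathrm{Sym}(X_n)$; and $H_2=\langle g_2,\ ((1,1)\,(1,2))\rangle\le \mathrm{Sym}(X_2)$, where $((1,1)\,(1,2))$ is the transposition of these two points. Let $\mathrm{FSym}(X_n)$ be the group of permutations of $X_n$ with finite support, and for $n\ge 3$ let $\pi:H_n\to\mathbb Z^{n-1}$ be the homomorphism with $\pi(g_k)=e_{k-1}$ for $k=2,\dots,n$, where $e_1,\dots,e_{n-1}$ is the standard basis. For a finitely generated group $G$ let $d(G)$ be the least size of a generating set of $G$. **Theorem.** (1) $d(H_2)=2$, and every finite-index subgroup $U$ of $H_2$ has $d(U)=d(H_2)=2$. (2) Let $n\ge3$. Then $d(H_n)=n-1$, and every finite-index subgroup $U$ of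 $H_n$ has $d(U)\in\{d(H_n),d(H_n)+1\}=\{n-1,n\}$. Furthermore, if $\pi(U)=\langle c_2e_1,\dots,c_ne_{n-1}\rangle$ with $c_2,\dots,c_n\in\mathbb N$, then $d(U)=d(H_n)+1=n$ if and only if both $\mathrm{FSym}(X_n)\le U$ and at most one of the indices $i\in\{2,\dots,n\}$ has $c_i$ odd. -/

import Mathlib

open Filter

namespace Houghton

/-- The set `X_n`: a disjoint union of `n` rays. Rays and the points of a ray are numbered from `0`,
so that `(i, m)` stands for the point usually written `(i + 1, m + 1)`. -/
abbrev X (n : ℕ) : Type := Fin n × ℕ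

/-- The first ray of `X_n`; it exists as soon as `Fin (n - 1)` has an element. -/
def ray₁ {n : ℕ} (k : Fin (n - 1)) : Fin n := ⟨0, by have := k.2; omega⟩

/-- The ray of `X_n` that is numbered by `k : Fin (n - 1)` among the rays other than the first. -/
def ray {n : ℕ} (k : Fin (n - 1)) : Fin n := ⟨k + 1, by have := k.2; omega⟩

theorem ray₁_ne_ray {n : ℕ} (k l : Fin (n - 1)) : ray₁ l ≠ ray k := by
  simp [ray₁, ray, Fin.ext_iff]

/-- The generators of the Houghton group: `gen k` pushes the first ray outwards by one,
pulls the ray `ray k` inwards by one, and carries the initial point of `ray k` to that of the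
first ray. With rays numbered from one, these are `g_2, …, g_n`. -/
def gen {n : ℕ} (k : Fin (n - 1)) : Equiv.Perm (X n) where
  toFun x :=
    if x.1 = ray₁ k then (ray₁ k, x.2 + 1)
    else if x.1 = ray k then (if x.2 = 0 then (ray₁ k, 0) else (ray k, x.2 - 1))
    else x
  invFun x :=
    if x.1 = ray₁ k then (if x.2 = 0 then (ray k, 0) else (ray₁ k, x.2 - 1))
    else if x.1 = ray k then (ray k, x.2 + 1)
    else x
  left_inv := by
    rintro ⟨i, m⟩
    have h := ray₁_ne_ray k k
    by_cases h1 : i = ray₁ k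
    · simp [h1]
    · by_cases h2 : i = ray k
      · by_cases hm : m = 0
        · simp [h2, hm, h.symm]
        · simp [h2, hm, h.symm]; omega
      · simp [h1, h2]
  right_inv := by
    rintro ⟨i, m⟩
    have h := ray₁_ne_ray k k
    by_cases h1 : i = ray₁ k
    · by_cases hm : m = 0
      · simp [h1, hm, h.symm]
      · simp [h1, hm]; omega
    · by_cases h2 : i = ray k
      · simp [h2, h.symm]
      · simp [h1, h2]

/-- The Houghton group `H_n` for `n ≥ 3`, generated by `g_2, …, g_n`.
(Only `n ≥ 3` is meant; the second Houghton group is `H₂`.) -/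
def H (n : ℕ) : Subgroup (Equiv.Perm (X n)) :=
  Subgroup.closure (Set.range (gen (n := n)))

/-- The second Houghton group, generated by `g_2` and the transposition of the first two points
of the first ray. -/
def H₂ : Subgroup (Equiv.Perm (X 2)) :=
  Subgroup.closure (insert (Equiv.swap (0, 0) (0, 1)) (Set.range (gen (n := 2))))

instance instFGH (n : ℕ) : Group.FG (H n) :=
  (Group.fg_iff_subgroup_fg _).2 ((Subgroup.fg_iff _).2 ⟨_, rfl, Set.finite_range _⟩)

instance instFGH₂ : Group.FG H₂ :=
  (Group.fg_iff_subgroup_fg _).2 ((Subgroup.fg_iff _).2 ⟨_, rfl, (Set.finite_range _).insert _⟩)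

/-- `FSym(α)`: the group of all permutations of `α` with finite support. -/
def FSym (α : Type*) : Subgroup (Equiv.Perm α) where
  carrier := {σ | {x | σ x ≠ x}.Finite}
  one_mem' := by simp
  mul_mem' {σ τ} hσ hτ := by
    refine (Set.Finite.union hσ hτ).subset fun x hx => ?_
    by_contra hc
    simp only [Set.mem_union, Set.mem_ofPred_eq, not_or, not_not] at hc
    exact hx (by rw [Equiv.Perm.mul_apply, hc.2, hc.1])
  inv_mem' {σ} hσ := by
    refine Set.Finite.subset hσ fun x hx hc => hx ?_
    rw [Equiv.Perm.inv_eq_iff_eq, hc]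

/-- `σ` is, far out on each ray `i`, the translation by `t i` along that ray. -/
def EventuallyTranslates {n : ℕ} (σ : Equiv.Perm (X n)) (t : Fin n → ℤ) : Prop :=
  ∀ i, ∃ N : ℕ, ∀ m : ℕ, N ≤ m → (σ (i, m)).1 = i ∧ ((σ (i, m)).2 : ℤ) = m + t i

theorem EventuallyTranslates.unique {n : ℕ} {σ : Equiv.Perm (X n)} {s t : Fin n → ℤ}
    (hs : EventuallyTranslates σ s) (ht : EventuallyTranslates σ t) : s = t := by
  funext i
  obtain ⟨N, hN⟩ := hs i
  obtain ⟨M, hM⟩ := ht i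
  have h1 := (hN (max N M) (le_max_left _ _)).2
  have h2 := (hM (max N M) (le_max_right _ _)).2
  linarith

theorem EventuallyTranslates.one {n : ℕ} :
    EventuallyTranslates (1 : Equiv.Perm (X n)) 0 := fun _ => ⟨0, fun _ _ => by simp⟩

theorem EventuallyTranslates.mul {n : ℕ} {σ τ : Equiv.Perm (X n)} {s t : Fin n → ℤ}
    (hs : EventuallyTranslates σ s) (ht : EventuallyTranslates τ t) :
    EventuallyTranslates (σ * τ) (s + t) := by
  intro i
  obtain ⟨N, hN⟩ := hs i
  obtain ⟨M, hM⟩ := ht i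
  refine ⟨M + N + (t i).natAbs, fun m hm => ?_⟩
  obtain ⟨h1, h2⟩ := hM m (by omega)
  have h3 : τ (i, m) = (i, (τ (i, m)).2) := Prod.ext h1 rfl
  obtain ⟨h4, h5⟩ := hN (τ (i, m)).2 (by omega)
  rw [Equiv.Perm.mul_apply, h3]
  exact ⟨h4, by rw [h5, h2, Pi.add_apply]; ring⟩

theorem EventuallyTranslates.inv {n : ℕ} {σ : Equiv.Perm (X n)} {s : Fin n → ℤ}
    (hs : EventuallyTranslates σ s) : EventuallyTranslates σ⁻¹ (-s) := by
  intro i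
  obtain ⟨N, hN⟩ := hs i
  refine ⟨N + (s i).natAbs, fun m hm => ?_⟩
  obtain ⟨h1, h2⟩ := hN ((m : ℤ) - s i).toNat (by omega)
  have h3 : σ⁻¹ (i, m) = (i, ((m : ℤ) - s i).toNat) := by
    rw [Equiv.Perm.inv_eq_iff_eq]
    exact Prod.ext h1.symm (by simp only; omega)
  rw [h3]
  exact ⟨rfl, by simp only [Pi.neg_apply]; omega⟩

theorem gen_eventuallyTranslates {n : ℕ} (k : Fin (n - 1)) :
    EventuallyTranslates (gen k) (Pi.single (ray₁ k) 1 - Pi.single (ray k) 1) := by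
  intro i
  have h := ray₁_ne_ray k k
  refine ⟨1, fun m hm => ?_⟩
  by_cases h1 : i = ray₁ k
  · subst h1
    simp [gen, h]
  · by_cases h2 : i = ray k
    · subst h2
      have hm' : m ≠ 0 := by omega
      simp [gen, h.symm, hm']
      omega
    · simp [gen, h1, h2]

theorem exists_eventuallyTranslates {n : ℕ} (σ : H n) :
    ∃ t, EventuallyTranslates (σ : Equiv.Perm (X n)) t := by
  obtain ⟨σ, hσ⟩ := σ
  induction hσ using Subgroup.closure_induction with
  | mem x hx => obtain ⟨k, rfl⟩ := hx; exact ⟨_, gen_eventuallyTranslates k⟩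
  | one => exact ⟨0, .one⟩
  | mul x y _ _ hx hy => exact ⟨_, hx.choose_spec.mul hy.choose_spec⟩
  | inv x _ hx => exact ⟨_, hx.choose_spec.inv⟩

/-- The translation lengths of an element of `H_n` along the rays. -/
noncomputable def transl {n : ℕ} (σ : H n) : Fin n → ℤ := (exists_eventuallyTranslates σ).choose

theorem transl_spec {n : ℕ} (σ : H n) :
    EventuallyTranslates (σ : Equiv.Perm (X n)) (transl σ) :=
  (exists_eventuallyTranslates σ).choose_spec

/-- The homomorphism `π : H_n → ℤ^(n-1)` with `π (g_k) = e_(k-1)` (see `π_gen`): its coordinate at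
`k` is the length by which an element translates the ray `ray k` inwards. -/
noncomputable def π (n : ℕ) : H n →* Multiplicative (Fin (n - 1) → ℤ) where
  toFun σ := Multiplicative.ofAdd fun k => -transl σ (ray k)
  map_one' := by
    have h : transl (1 : H n) = 0 := (transl_spec 1).unique .one
    simp only [h, Pi.zero_apply, neg_zero]
    rfl
  map_mul' σ τ := by
    have h : transl (σ * τ) = transl σ + transl τ :=
      (transl_spec (σ * τ)).unique ((transl_spec σ).mul (transl_spec τ))
    rw [← ofAdd_add, h]
    congr 1
    funext k
    simp only [Pi.add_apply]
    ring

/-- The generator `g_k` as an element of `H_n`. -/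
def genH {n : ℕ} (k : Fin (n - 1)) : H n := ⟨gen k, Subgroup.subset_closure ⟨k, rfl⟩⟩

/-- `π` is the homomorphism that sends the generators to the standard basis of `ℤ^(n-1)`. -/
theorem π_gen {n : ℕ} (k : Fin (n - 1)) :
    π n (genH k) = Multiplicative.ofAdd (Pi.single k 1) := by
  have h : transl (genH k) = _ := (transl_spec (genH k)).unique (gen_eventuallyTranslates k)
  change Multiplicative.ofAdd (fun l => -transl (genH k) (ray l)) = _
  rw [h]
  congr 1
  funext l
  have h1 : ray l ≠ ray₁ k := (ray₁_ne_ray l k).symm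
  by_cases hl : l = k
  · subst hl; simp [h1]
  · have h2 : ray l ≠ ray k := fun hc => hl (by
      simp only [ray, Fin.mk.injEq] at hc; exact Fin.ext (by omega))
    simp [h1, h2, hl]

end Houghton

/-!
Write `FAlt` for the group generated by the three-cycles; it has index two in `FSym`.

A subgroup `U` of finite index in a Houghton group contains `FAlt`: among infinitely many
transpositions `(x p)` two lie in the same coset of the normal core of `U`, so the core contains a
three-cycle, and all three-cycles are conjugate (`FAlt_le_of_finiteIndex`). The kernel of `π` is
`FSym`, so `U` is determined up to `FAlt` by a lattice of rank `n - 1` and by whether `U` contains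
odd finitary permutations. The lattice gives the lower bound `n - 1` for the number of generators
(`le_rank`).

The upper bound rests on `exists_FAlt_le_closure`. Let `a` be a permutation with finitely many
orbits, only finitely many points of which lie on finite orbits, and let `b` commute with `a` up
to a finitary permutation `w`. Then `b` can be changed by an element of `FAlt` so that `a` and `b`
generate a group containing `FAlt`. To see this, replace `b` by `c * b`, where `c` is a cycle of
large prime length `p` on a set `S` that is disjoint from the supports of `w` and of its conjugate
by `a`, and that meets all infinite orbits of `a`. The commutator of `a` and `c * b` is `w` times
`γ = (a c a⁻¹) c⁻¹`; these commute and `p` is prime to the order of `w`, so a power of it is `γ`.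
If `S` is chosen such that `γ` and its conjugate by `a²` have exactly one common moved point, then
their commutator is a three-cycle (`commutator_eq_threeCycle`). Being equal or related by a
three-cycle of a group `G` is a `G`-invariant equivalence relation `Linked G`, and if it has only
one class then `FAlt ≤ G` (`FAlt_le_of_linked`). The choice of `S` makes all points on infinite
orbits of `a` equivalent; the remaining points are reached since `b` can be arranged to move all
of them to infinite orbits of `a`.

For `n ≥ 3` the lemma applies to two of `n - 1` elements of `U` that lift generators of the lattice,
where the first is chosen to translate all rays by nonzero lengths (`exists_generators`). Hence `U`
has `n - 1` generators, or `n` if an odd permutation has to be added. For `H₂` the lemma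
applies with a finitary `b`, so that the second generator is a finitary element of `U`.

If `FSym ≤ U`, then `n - 1` generators suffice exactly if `U / FAlt` is not commutative. If the
commutator of two elements is odd, then so is that of their approximations by words in the
`n - 1` generators, since finitary permutations are central modulo `FAlt`
(`rank_le_of_not_commute`); and if `U / FAlt` is commutative, then `n - 1` generators would map to
linearly independent vectors, so that all finitary elements of `U` would be even
(`mem_FAlt_of_rank_eq`). For the lattice spanned by the `c k • e k`, the question is settled by the
sign of the commutator of `gen j ^ c j` and `gen k ^ c k`, which is `(-1) ^ (c j * c k)`
(`commute_modFAlt_gen_pow_iff`).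
-/

namespace Houghton

open Equiv Equiv.Perm

/-! ### Finitary permutations, three-cycles and the finitary alternating group -/

section Finitary

variable {α : Type*}

theorem mem_FSym {σ : Perm α} : σ ∈ FSym α ↔ {x | σ x ≠ x}.Finite := Iff.rfl

theorem conj_mem_FSym (g : Perm α) {σ : Perm α} (h : σ ∈ FSym α) : g * σ * g⁻¹ ∈ FSym α := by
  refine (Set.Finite.image g h).subset fun x hx => ⟨g⁻¹ x, fun hc => hx ?_, by simp⟩
  rw [Perm.mul_apply, Perm.mul_apply, hc]
  simp

variable [DecidableEq α]

theorem closure_isSwap : Subgroup.closure {σ : Perm α | σ.IsSwap} = FSym α := by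
  ext σ
  rw [mem_closure_isSwap', mem_FSym]
  rfl

theorem swap_mem_FSym (a b : α) : swap a b ∈ FSym α := by
  by_cases h : a = b
  · subst h; rw [swap_self]; exact one_mem _
  · rw [← closure_isSwap]; exact Subgroup.subset_closure ⟨a, b, h, rfl⟩

/-- The three-cycle `a ↦ b ↦ c ↦ a` (when `a`, `b`, `c` are distinct). -/
def threeCycle (a b c : α) : Perm α := swap a b * swap b c

theorem conj_threeCycle (g : Perm α) (a b c : α) :
    g * threeCycle a b c * g⁻¹ = threeCycle (g a) (g b) (g c) := by
  simp only [threeCycle, Equiv.swap_apply_apply]; group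

theorem threeCycle_rotate {a b c : α} (hab : a ≠ b) (hbc : b ≠ c) (hac : a ≠ c) :
    threeCycle b c a = threeCycle a b c := by
  ext x; simp only [threeCycle, Perm.mul_apply, swap_apply_def]; grind

theorem threeCycle_inv {a b c : α} (hab : a ≠ b) (hbc : b ≠ c) (hac : a ≠ c) :
    (threeCycle a b c)⁻¹ = threeCycle b a c := by
  rw [inv_eq_iff_mul_eq_one]
  ext x; simp only [threeCycle, Perm.mul_apply, swap_apply_def, Perm.one_apply]; grind

variable (α) in
/-- The finitary alternating group, as the group generated by the three-cycles. -/
def FAlt : Subgroup (Perm α) :=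
  Subgroup.closure {σ | ∃ a b c : α, a ≠ b ∧ b ≠ c ∧ a ≠ c ∧ σ = threeCycle a b c}

theorem threeCycle_mem_FAlt {a b c : α} (hab : a ≠ b) (hbc : b ≠ c) (hac : a ≠ c) :
    threeCycle a b c ∈ FAlt α :=
  Subgroup.subset_closure ⟨a, b, c, hab, hbc, hac, rfl⟩

theorem FAlt_le {G : Subgroup (Perm α)}
    (h : ∀ a b c : α, a ≠ b → b ≠ c → a ≠ c → threeCycle a b c ∈ G) : FAlt α ≤ G := by
  rw [FAlt, Subgroup.closure_le]
  rintro _ ⟨a, b, c, hab, hbc, hac, rfl⟩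
  exact h a b c hab hbc hac

theorem FAlt_le_FSym : FAlt α ≤ FSym α :=
  FAlt_le fun a b c _ _ _ => mul_mem (swap_mem_FSym a b) (swap_mem_FSym b c)

theorem conj_mem_FAlt (g : Perm α) {σ : Perm α} (h : σ ∈ FAlt α) : g * σ * g⁻¹ ∈ FAlt α := by
  suffices FAlt α ≤ (FAlt α).comap (MulAut.conj g).toMonoidHom from this h
  refine FAlt_le fun a b c hab hbc hac => ?_
  change g * threeCycle a b c * g⁻¹ ∈ FAlt α
  rw [conj_threeCycle]
  exact threeCycle_mem_FAlt (by simpa) (by simpa) (by simpa)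

theorem swap_mul_swap_mem_FAlt_aux {a b d : α} (hab : a ≠ b) (hbd : b ≠ d) :
    swap a b * swap b d ∈ FAlt α := by
  by_cases had : a = d
  · subst had; simp [swap_comm b a, one_mem]
  · exact threeCycle_mem_FAlt hab hbd had

theorem swap_mul_swap_mem_FAlt {a b c d : α} (hab : a ≠ b) (hcd : c ≠ d) :
    swap a b * swap c d ∈ FAlt α := by
  by_cases hbc : b = c
  · subst hbc; exact swap_mul_swap_mem_FAlt_aux hab hcd
  · have := mul_mem (swap_mul_swap_mem_FAlt_aux hab hbc) (swap_mul_swap_mem_FAlt_aux hbc hcd)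
    rwa [mul_assoc, swap_mul_self_mul] at this

/-- The finitary alternating group has index at most two in the finitary symmetric group. -/
theorem mem_FAlt_or_swap_mul_mem {σ : Perm α} (h : σ ∈ FSym α) :
    σ ∈ FAlt α ∨ ∀ a b : α, a ≠ b → swap a b * σ ∈ FAlt α := by
  rw [← closure_isSwap] at h
  have key : ∀ x : Perm α, x.IsSwap → ∀ y : Perm α,
      (y ∈ FAlt α ∨ ∀ a b : α, a ≠ b → swap a b * y ∈ FAlt α) →
      (x * y ∈ FAlt α ∨ ∀ a b : α, a ≠ b → swap a b * (x * y) ∈ FAlt α) := by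
    rintro _ ⟨c, d, hcd, rfl⟩ y (hy | hy)
    · right
      intro a b hab
      rw [← mul_assoc]
      exact mul_mem (swap_mul_swap_mem_FAlt hab hcd) hy
    · exact Or.inl (hy c d hcd)
  induction h using Subgroup.closure_induction_left with
  | one => exact Or.inl (one_mem _)
  | mul_left x hx y _ ih => exact key x hx y ih
  | inv_mul_cancel x hx y _ ih =>
    refine key _ ?_ y ih
    obtain ⟨c, d, hcd, rfl⟩ := hx
    exact ⟨c, d, hcd, swap_inv c d⟩

theorem mul_self_mem_FAlt {σ : Perm α} (h : σ ∈ FSym α) : σ * σ ∈ FAlt α := by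
  by_cases hs : σ = 1
  · subst hs; simp [one_mem]
  rcases mem_FAlt_or_swap_mul_mem h with h | h
  · exact mul_mem h h
  · obtain ⟨x, hx⟩ : ∃ x, σ x ≠ x := by
      by_contra! hc
      exact hs (Perm.ext hc)
    have h1 := h _ _ hx
    have h2 := mul_mem (conj_mem_FAlt (swap (σ x) x) h1) h1
    simpa [mul_assoc] using h2

/-- A finitary permutation of odd order is even. -/
theorem mem_FAlt_of_pow_eq_one {σ : Perm α} (h : σ ∈ FSym α) {p : ℕ} (hp : Odd p)
    (hσ : σ ^ p = 1) : σ ∈ FAlt α := by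
  obtain ⟨k, rfl⟩ := hp
  have h1 : σ = σ ^ (k + 1) * σ ^ (k + 1) := by
    rw [← pow_add, show k + 1 + (k + 1) = (2 * k + 1) + 1 by ring, pow_succ, hσ, one_mul]
  rw [h1]
  exact mul_self_mem_FAlt (pow_mem h _)

/-- Transpositions are not even. An element of `FAlt α` lives on a finite set, and on every larger
finite set it has sign one. -/
theorem swap_notMem_FAlt {a b : α} (hab : a ≠ b) : swap a b ∉ FAlt α := by
  intro h
  have key : ∀ σ ∈ FAlt α, ∃ S : Finset α, ∀ T : Finset α, S ⊆ T →
      ∃ τ : Perm {x // x ∈ T}, sign τ = 1 ∧ ofSubtype τ = σ := by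
    intro σ hσ
    induction hσ using Subgroup.closure_induction with
    | mem x hx =>
      obtain ⟨a, b, c, hab, hbc, hac, rfl⟩ := hx
      refine ⟨{a, b, c}, fun T hT => ?_⟩
      have ha : a ∈ T := hT (by simp)
      have hb : b ∈ T := hT (by simp)
      have hc : c ∈ T := hT (by simp)
      refine ⟨swap ⟨a, ha⟩ ⟨b, hb⟩ * swap ⟨b, hb⟩ ⟨c, hc⟩, ?_, ?_⟩
      · rw [Perm.sign_mul, sign_swap (by simpa using hab), sign_swap (by simpa using hbc)]
        rfl
      · rw [map_mul, ofSubtype_swap_eq, ofSubtype_swap_eq]; rfl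
    | one => exact ⟨∅, fun T _ => ⟨1, by simp, by simp⟩⟩
    | mul x y _ _ hx hy =>
      obtain ⟨S, hS⟩ := hx
      obtain ⟨S', hS'⟩ := hy
      refine ⟨S ∪ S', fun T hT => ?_⟩
      obtain ⟨τ, h1, rfl⟩ := hS T (Finset.union_subset_left hT)
      obtain ⟨τ', h1', rfl⟩ := hS' T (Finset.union_subset_right hT)
      exact ⟨τ * τ', by rw [Perm.sign_mul, h1, h1', one_mul], map_mul _ _ _⟩
    | inv x _ hx =>
      obtain ⟨S, hS⟩ := hx
      refine ⟨S, fun T hT => ?_⟩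
      obtain ⟨τ, h1, rfl⟩ := hS T hT
      exact ⟨τ⁻¹, by rw [Perm.sign_inv, h1], map_inv _ _⟩
  obtain ⟨S, hS⟩ := key _ h
  obtain ⟨τ, h1, h2⟩ := hS (S ∪ {a, b}) Finset.subset_union_left
  have ha : a ∈ S ∪ {a, b} := by simp
  have hb : b ∈ S ∪ {a, b} := by simp
  have h3 : τ = swap ⟨a, ha⟩ ⟨b, hb⟩ := by
    apply ofSubtype_injective
    rw [h2, ofSubtype_swap_eq]
  rw [h3, sign_swap (by simpa using hab)] at h1
  exact absurd h1 (by decide)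

theorem FSym_le_of_FAlt_le {G : Subgroup (Perm α)} (h : FAlt α ≤ G) {σ : Perm α} (hσ : σ ∈ FSym α)
    (hσ' : σ ∉ FAlt α) (hG : σ ∈ G) : FSym α ≤ G := by
  rw [← closure_isSwap, Subgroup.closure_le]
  rintro _ ⟨a, b, hab, rfl⟩
  have h1 := ((mem_FAlt_or_swap_mul_mem hσ).resolve_left hσ') a b hab
  simpa using mul_mem (h h1) (inv_mem hG)

/-- Two odd finitary permutations differ by an even one. -/
theorem mul_mem_FAlt_of_odd [Nontrivial α] {σ τ : Perm α} (hσ : σ ∈ FSym α) (hσ' : σ ∉ FAlt α)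
    (hτ : τ ∈ FSym α) (hτ' : τ ∉ FAlt α) : σ * τ ∈ FAlt α := by
  obtain ⟨a, b, hab⟩ := exists_pair_ne α
  have h1 := ((mem_FAlt_or_swap_mul_mem hσ).resolve_left hσ') a b hab
  have h2 := ((mem_FAlt_or_swap_mul_mem hτ).resolve_left hτ') a b hab
  have h3 := mul_mem (conj_mem_FAlt (swap a b) h1) h2
  simpa [mul_assoc] using h3

end Finitary

/-! ### A criterion for containing the finitary alternating group -/

section Criterion

variable {α : Type*} [DecidableEq α]

/-- If exactly one point `x` is moved by both `f` and `g`, then the commutator of `f` and `g` is a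
three-cycle. -/
theorem commutator_eq_threeCycle {f g : Perm α} {x : α} (hf : f x ≠ x) (hg : g x ≠ x)
    (h : ∀ y, f y ≠ y → g y ≠ y → y = x) :
    f * g * f⁻¹ * g⁻¹ = threeCycle x (f x) (g x) := by
  have gf : g (f x) = f x := by
    by_contra hc; exact hf (h _ (fun h' => hf (f.injective h')) hc)
  have fg : f (g x) = g x := by
    by_contra hc; exact hg (h _ hc (fun h' => hg (g.injective h')))
  have hfg : f x ≠ g x := fun hc => hg (g.injective (by rw [← hc, gf]))
  have e : f * g = threeCycle x (f x) (g x) * (g * f) := by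
    have cx : threeCycle x (f x) (g x) x = f x := by
      simp [threeCycle, swap_apply_of_ne_of_ne hf.symm hg.symm]
    have cf : threeCycle x (f x) (g x) (f x) = g x := by
      simp [threeCycle, swap_apply_of_ne_of_ne hg hfg.symm]
    have cg : threeCycle x (f x) (g x) (g x) = x := by
      simp [threeCycle]
    have cne : ∀ z, z ≠ x → z ≠ f x → z ≠ g x → threeCycle x (f x) (g x) z = z := by
      intro z h1 h2 h3
      rw [threeCycle, Perm.mul_apply, swap_apply_of_ne_of_ne h2 h3, swap_apply_of_ne_of_ne h1 h2]
    ext y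
    simp only [Perm.mul_apply]
    by_cases hyx : y = x
    · rw [hyx, fg, gf, cf]
    by_cases hgy : g y = y
    · rw [hgy]
      by_cases hfx : f y = x
      · rw [hfx, cg]
      · have h1 : g (f y) = f y := by
          by_contra hc
          refine hfx (h _ (fun h' => hc ?_) hc)
          rw [f.injective h', hgy]
        rw [h1, cne _ hfx (fun h' => hyx (f.injective h'))]
        intro h'
        have : y = g x := f.injective (h'.trans fg.symm)
        exact hg (g.injective (by rw [← this, hgy]))
    · have hfy : f y = y := by
        by_contra hc; exact hyx (h y hc hgy)
      rw [hfy]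
      by_cases hgx : g y = x
      · rw [hgx, cx]
      · have h1 : f (g y) = g y := by
          by_contra hc
          exact hgx (h _ hc (fun h' => hgy (g.injective h')))
        rw [h1, cne _ hgx _ (fun h' => hyx (g.injective h'))]
        intro h'
        have : y = f x := g.injective (h'.trans gf.symm)
        exact hf (f.injective (by rw [← this, hfy]))
  rw [e]; group

end Criterion

section Linked

variable {α : Type*} [DecidableEq α]

theorem threeCycle_apply_fst {a b c : α} (hab : a ≠ b) (hac : a ≠ c) :
    threeCycle a b c a = b := by
  simp [threeCycle, swap_apply_of_ne_of_ne hab hac]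

theorem threeCycle_apply_snd {a b c : α} (hbc : b ≠ c) (hac : a ≠ c) :
    threeCycle a b c b = c := by
  simp [threeCycle, swap_apply_of_ne_of_ne hac.symm hbc.symm]

theorem threeCycle_apply_trd (a b c : α) : threeCycle a b c c = a := by
  simp [threeCycle]

theorem threeCycle_apply_of_ne {a b c x : α} (ha : x ≠ a) (hb : x ≠ b) (hc : x ≠ c) :
    threeCycle a b c x = x := by
  rw [threeCycle, Perm.mul_apply, swap_apply_of_ne_of_ne hb hc, swap_apply_of_ne_of_ne ha hb]

/-- Two points are linked by `G` if they are equal or some three-cycle of `G` moves one to the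
other. This is an equivalence relation that `G` preserves. -/
def Linked (G : Subgroup (Perm α)) (x y : α) : Prop :=
  x = y ∨ ∃ z, x ≠ y ∧ y ≠ z ∧ x ≠ z ∧ threeCycle x y z ∈ G

variable {G : Subgroup (Perm α)}

theorem threeCycle_mem_rotate {a b c : α} (hab : a ≠ b) (hbc : b ≠ c) (hac : a ≠ c)
    (h : threeCycle a b c ∈ G) : threeCycle b c a ∈ G := by
  rwa [threeCycle_rotate hab hbc hac]

theorem threeCycle_mem_flip {a b c : α} (hab : a ≠ b) (hbc : b ≠ c) (hac : a ≠ c)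
    (h : threeCycle a b c ∈ G) : threeCycle b a c ∈ G := by
  rw [← threeCycle_inv hab hbc hac]; exact inv_mem h

theorem conj_threeCycle_mem {g : Perm α} (hg : g ∈ G) {a b c : α} (h : threeCycle a b c ∈ G) :
    threeCycle (g a) (g b) (g c) ∈ G := by
  rw [← conj_threeCycle]; exact mul_mem (mul_mem hg h) (inv_mem hg)

theorem Linked.refl (x : α) : Linked G x x := Or.inl rfl

theorem Linked.symm {x y : α} (h : Linked G x y) : Linked G y x := by
  rcases h with rfl | ⟨z, h1, h2, h3, h⟩
  · exact .refl _
  · exact Or.inr ⟨z, h1.symm, h3, h2, threeCycle_mem_flip h1 h2 h3 h⟩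

theorem Linked.map {g : Perm α} (hg : g ∈ G) {x y : α} (h : Linked G x y) :
    Linked G (g x) (g y) := by
  rcases h with rfl | ⟨z, h1, h2, h3, h⟩
  · exact .refl _
  · exact Or.inr ⟨g z, by simpa, by simpa, by simpa, conj_threeCycle_mem hg h⟩

theorem Linked.trans {x y d : α} (h : Linked G x y) (h' : Linked G y d) : Linked G x d := by
  rcases h with rfl | ⟨c, hxy, hyc, hxc, h⟩
  · exact h'
  rcases h' with rfl | ⟨e, hyd, hde, hye, h'⟩
  · exact Or.inr ⟨c, hxy, hyc, hxc, h⟩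
  by_cases hxd : x = d
  · exact Or.inl hxd
  right
  by_cases hdc : d = c
  · subst hdc
    exact ⟨y, hxc, hyc.symm, hxy, threeCycle_mem_rotate hxy.symm hxc hyc
      (threeCycle_mem_flip hxy hyc hxc h)⟩
  by_cases hec : e = c
  · subst hec
    have h1 := conj_threeCycle_mem h h'
    rw [threeCycle_apply_snd hyc hxc, threeCycle_apply_trd,
      threeCycle_apply_of_ne (Ne.symm hxd) hyd.symm hdc] at h1
    exact ⟨e, hxd, hde, hxc, threeCycle_mem_flip (Ne.symm hxd) hxc hde
      (threeCycle_mem_rotate (Ne.symm hdc) (Ne.symm hxd) hxc.symm h1)⟩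
  by_cases hex : e = x
  · subst hex
    exact ⟨y, hxd, hyd.symm, hxy, threeCycle_mem_flip hde hxy hyd.symm
      (threeCycle_mem_rotate hyd hde hye h')⟩
  · have h1 := conj_threeCycle_mem h' h
    rw [threeCycle_apply_fst hyd hye, threeCycle_apply_of_ne hxy hxd (Ne.symm hex),
      threeCycle_apply_of_ne hyc.symm (Ne.symm hdc) (Ne.symm hec)] at h1
    exact ⟨c, hxd, hdc, hxc, h1⟩

/-- Two three-cycles that agree in a pair of points generate the alternating group on the four
points involved. -/
theorem threeCycle_mem_of_mem_of_mem {x y z c : α} (hxy : x ≠ y) (hyz : y ≠ z) (hxz : x ≠ z)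
    (hxc : x ≠ c) (hyc : y ≠ c) (h : threeCycle x y c ∈ G)
    (h' : threeCycle x z c ∈ G) : threeCycle x y z ∈ G := by
  have h1 := conj_threeCycle_mem h' h
  rw [threeCycle_apply_fst hxz hxc, threeCycle_apply_of_ne hxy.symm hyz hyc,
    threeCycle_apply_trd] at h1
  exact threeCycle_mem_flip hxy.symm hxz hyz
    (threeCycle_mem_rotate hyz.symm hxy.symm hxz.symm h1)

theorem FAlt_le_of_linked (h : ∀ x y, Linked G x y) : FAlt α ≤ G := by
  refine FAlt_le fun x y z hxy hyz hxz => ?_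
  rcases h x y with h1 | ⟨c, -, hyc, hxc, h1⟩
  · exact absurd h1 hxy
  by_cases hzc : z = c
  · rwa [hzc]
  rcases h x z with h2 | ⟨d, -, hzd, hxd, h2⟩
  · exact absurd h2 hxz
  have h3 : threeCycle x z y ∈ G ∨ threeCycle x z c ∈ G := by
    by_cases hdy : d = y
    · subst hdy; exact Or.inl h2
    by_cases hdc : d = c
    · subst hdc; exact Or.inr h2
    · right
      have h4 := conj_threeCycle_mem h1 h2
      rw [threeCycle_apply_fst hxy hxc, threeCycle_apply_of_ne hxz.symm hyz.symm hzc,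
        threeCycle_apply_of_ne hxd.symm hdy hdc] at h4
      have h5 := conj_threeCycle_mem h4 h1
      rwa [threeCycle_apply_fst hyz (Ne.symm hdy), threeCycle_apply_of_ne hxy hxz hxd,
        threeCycle_apply_of_ne hyc.symm (Ne.symm hzc) (Ne.symm hdc)] at h5
  rcases h3 with h3 | h3
  · exact threeCycle_mem_flip hxy.symm hxz hyz
      (threeCycle_mem_rotate hyz.symm hxy.symm hxz.symm
        (threeCycle_mem_rotate hxz hyz.symm hxy h3))
  · exact threeCycle_mem_of_mem_of_mem hxy hyz hxz hxc hyc h1 h3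

end Linked

/-! ### Sparse sets along the orbits of a permutation -/

section Spread

variable {α : Type*}

/-- The point `x` lies on an infinite orbit of `a`. -/
def FreeAt (a : Perm α) (x : α) : Prop := ∀ k : ℤ, (a ^ k) x = x → k = 0

variable {a : Perm α}

theorem zpow_apply_zpow_apply (a : Perm α) (i j : ℤ) (x : α) :
    (a ^ i) ((a ^ j) x) = (a ^ (i + j)) x := by
  rw [zpow_add, Perm.mul_apply]

theorem FreeAt.injective {x : α} (h : FreeAt a x) : Function.Injective fun k : ℤ => (a ^ k) x := by
  intro i j hij
  have h1 : (a ^ (-j + i)) x = x := by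
    rw [← zpow_apply_zpow_apply]
    change (a ^ (-j)) ((fun k : ℤ => (a ^ k) x) i) = x
    rw [hij, zpow_apply_zpow_apply]
    simp
  have := h _ h1
  omega

theorem FreeAt.zpow {x : α} (h : FreeAt a x) (k : ℤ) : FreeAt a ((a ^ k) x) := by
  intro i hi
  rw [zpow_apply_zpow_apply] at hi
  have := h.injective (a₁ := i + k) (a₂ := k) hi
  omega

theorem FreeAt.exists_zpow_notMem {x : α} (h : FreeAt a x) {E : Set α} (hE : E.Finite) :
    ∃ k : ℤ, (a ^ k) x ∉ E := by
  by_contra! hc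
  exact Set.infinite_univ ((hE.preimage h.injective.injOn).subset fun k _ => hc k)

/-- The finite set `S` avoids `E` and consists of points on infinite orbits of `a`; the only
coincidence between `S` and its translates by `a`, `a²`, `a³` is that `a³ z` lies in `S`;
and `S` contains `z`, `a³ z`, `a⁷ z`. -/
structure IsSpread (a : Perm α) (E : Set α) (z : α) (S : Finset α) : Prop where
  free : ∀ s ∈ S, FreeAt a s
  notMem : ∀ s ∈ S, s ∉ E
  one : ∀ s ∈ S, (a ^ (1 : ℤ)) s ∉ S
  two : ∀ s ∈ S, (a ^ (2 : ℤ)) s ∉ S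
  three : ∀ s ∈ S, (a ^ (3 : ℤ)) s ∈ S → s = z
  mem_zero : z ∈ S
  mem_three : (a ^ (3 : ℤ)) z ∈ S
  mem_seven : (a ^ (7 : ℤ)) z ∈ S

variable [DecidableEq α]

theorem exists_isSpread {r : α} (hr : FreeAt a r) {E : Set α} (hE : E.Finite) :
    ∃ z S, IsSpread a E z S := by
  have hfin : (E ∪ (a ^ (3 : ℤ)) ⁻¹' E ∪ (a ^ (7 : ℤ)) ⁻¹' E).Finite :=
    (hE.union (hE.preimage (a ^ (3 : ℤ)).injective.injOn)).union
      (hE.preimage (a ^ (7 : ℤ)).injective.injOn)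
  obtain ⟨k, hk⟩ := hr.exists_zpow_notMem hfin
  set z := (a ^ k) r with hz
  have hzf : FreeAt a z := hr.zpow k
  have inj : ∀ i j : ℤ, (a ^ i) z = (a ^ j) z → i = j := fun i j h => hzf.injective h
  have h0 : (a ^ (0 : ℤ)) z = z := by simp
  simp only [Set.mem_union, Set.mem_preimage, not_or] at hk
  refine ⟨z, {(a ^ (0 : ℤ)) z, (a ^ (3 : ℤ)) z, (a ^ (7 : ℤ)) z}, ⟨?_, ?_, ?_, ?_, ?_, ?_, ?_, ?_⟩⟩
  · simp only [Finset.mem_insert, Finset.mem_singleton]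
    rintro s (rfl | rfl | rfl) <;> exact hzf.zpow _
  · simp only [Finset.mem_insert, Finset.mem_singleton]
    rintro s (rfl | rfl | rfl)
    · rw [h0]; exact hk.1.1
    · exact hk.1.2
    · exact hk.2
  · simp only [Finset.mem_insert, Finset.mem_singleton, forall_eq_or_imp, forall_eq,
      zpow_apply_zpow_apply]
    refine ⟨?_, ?_, ?_⟩ <;>
    · rintro (h | h | h) <;> have := inj _ _ h <;> omega
  · simp only [Finset.mem_insert, Finset.mem_singleton, forall_eq_or_imp, forall_eq,
      zpow_apply_zpow_apply]
    refine ⟨?_, ?_, ?_⟩ <;>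
    · rintro (h | h | h) <;> have := inj _ _ h <;> omega
  · simp only [Finset.mem_insert, Finset.mem_singleton, forall_eq_or_imp, forall_eq,
      zpow_apply_zpow_apply]
    refine ⟨fun _ => h0, ?_, ?_⟩ <;>
    · rintro (h | h | h) <;> have := inj _ _ h <;> omega
  · simp
  · simp
  · simp

theorem IsSpread.exists_insert {E : Set α} {z : α} {S : Finset α} (h : IsSpread a E z S)
    (hE : E.Finite) {r : α} (hr : FreeAt a r) :
    ∃ k : ℤ, (a ^ k) r ∉ S ∧ IsSpread a E z (insert ((a ^ k) r) S) := by
  have hfin : (E ∪ ⋃ j ∈ Finset.Icc (-3 : ℤ) 3, (a ^ j) ⁻¹' (S : Set α)).Finite := by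
    refine hE.union (Set.Finite.biUnion (Finset.finite_toSet _) fun j _ => ?_)
    exact S.finite_toSet.preimage (a ^ j).injective.injOn
  obtain ⟨k, hk⟩ := hr.exists_zpow_notMem hfin
  set t := (a ^ k) r with ht
  have htf : FreeAt a t := hr.zpow k
  simp only [Set.mem_union, Set.mem_iUnion, not_or, not_exists, Set.mem_preimage,
    Finset.mem_Icc, Finset.mem_coe] at hk
  obtain ⟨hkE, hkS⟩ := hk
  have ht0 : t ∉ S := by simpa using hkS 0 (by norm_num)
  -- no element of `S` is moved to `t` by a small power of `a`
  have hback : ∀ j : ℤ, -3 ≤ j → j ≤ 3 → ∀ s ∈ S, (a ^ j) s ≠ t := by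
    intro j h1 h2 s hs hst
    refine hkS (-j) ⟨by omega, by omega⟩ ?_
    rw [← hst, zpow_apply_zpow_apply]
    simpa using hs
  have hself : ∀ j : ℤ, j ≠ 0 → (a ^ j) t ≠ t := fun j hj hc => hj (htf j hc)
  refine ⟨k, ht0, ⟨?_, ?_, ?_, ?_, ?_, Finset.mem_insert_of_mem h.mem_zero,
    Finset.mem_insert_of_mem h.mem_three, Finset.mem_insert_of_mem h.mem_seven⟩⟩
  · intro s hs
    rcases Finset.mem_insert.1 hs with rfl | hs
    exacts [htf, h.free s hs]
  · intro s hs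
    rcases Finset.mem_insert.1 hs with rfl | hs
    exacts [hkE, h.notMem s hs]
  · intro s hs hc
    rcases Finset.mem_insert.1 hs with rfl | hs <;> rcases Finset.mem_insert.1 hc with hc | hc
    exacts [hself 1 (by norm_num) hc, hkS 1 (by norm_num) hc,
      hback 1 (by norm_num) (by norm_num) s hs hc, h.one s hs hc]
  · intro s hs hc
    rcases Finset.mem_insert.1 hs with rfl | hs <;> rcases Finset.mem_insert.1 hc with hc | hc
    exacts [hself 2 (by norm_num) hc, hkS 2 (by norm_num) hc,
      hback 2 (by norm_num) (by norm_num) s hs hc, h.two s hs hc]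
  · intro s hs hc
    rcases Finset.mem_insert.1 hs with rfl | hs <;> rcases Finset.mem_insert.1 hc with hc | hc
    exacts [absurd hc (hself 3 (by norm_num)), absurd hc (hkS 3 (by norm_num)),
      absurd hc (hback 3 (by norm_num) (by norm_num) s hs), h.three s hs hc]

theorem IsSpread.exists_meets {E : Set α} {z : α} {S : Finset α} (h : IsSpread a E z S)
    (hE : E.Finite) (R : Finset α) :
    ∃ T, IsSpread a E z T ∧ ∀ r ∈ R, FreeAt a r → ∃ k : ℤ, (a ^ k) r ∈ T := by
  induction R using Finset.induction_on with
  | empty => exact ⟨S, h, by simp⟩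
  | insert r R _ ih =>
    obtain ⟨T, hT, hR⟩ := ih
    by_cases hr : FreeAt a r
    · obtain ⟨k, -, hk⟩ := hT.exists_insert hE hr
      refine ⟨_, hk, fun x hx hxf => ?_⟩
      rcases Finset.mem_insert.1 hx with rfl | hx
      · exact ⟨k, Finset.mem_insert_self _ _⟩
      · obtain ⟨j, hj⟩ := hR x hx hxf
        exact ⟨j, Finset.mem_insert_of_mem hj⟩
    · refine ⟨T, hT, fun x hx hxf => ?_⟩
      rcases Finset.mem_insert.1 hx with rfl | hx
      · exact absurd hxf hr
      · exact hR x hx hxf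

theorem IsSpread.exists_card_eq {E : Set α} {z : α} {S : Finset α} (h : IsSpread a E z S)
    (hE : E.Finite) (n : ℕ) : ∃ T, S ⊆ T ∧ IsSpread a E z T ∧ T.card = S.card + n := by
  induction n with
  | zero => exact ⟨S, subset_rfl, h, rfl⟩
  | succ n ih =>
    obtain ⟨T, hST, hT, hcard⟩ := ih
    obtain ⟨k, hk, hk'⟩ := hT.exists_insert hE (hT.free z hT.mem_zero)
    exact ⟨_, hST.trans (Finset.subset_insert _ _), hk',
      by rw [Finset.card_insert_of_notMem hk, hcard, add_assoc]⟩

end Spread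

/-! ### Generating the finitary alternating group by two elements -/

section TwoGenerators

variable {α : Type*}

theorem exists_pow_eq_one_of_mem_FSym {w : Perm α} (hw : w ∈ FSym α) :
    ∃ m : ℕ, 0 < m ∧ w ^ m = 1 := by
  have hfin : Finite {x // w x ≠ x} := hw
  have hinv : ∀ x, w (w x) ≠ w x ↔ w x ≠ x := fun x => by simp
  obtain ⟨m, hm, h1⟩ : ∃ m : ℕ, 0 < m ∧ (w.subtypePerm (p := fun x => w x ≠ x) hinv) ^ m = 1 :=
    ⟨_, orderOf_pos _, pow_orderOf_eq_one _⟩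
  refine ⟨m, hm, Perm.ext fun x => ?_⟩
  by_cases hx : w x = x
  · exact Function.IsFixedPt.perm_pow hx _
  · rw [subtypePerm_pow] at h1
    exact congrArg Subtype.val (Equiv.congr_fun h1 ⟨x, hx⟩)

variable [DecidableEq α]

theorem Linked.zpow {G : Subgroup (Perm α)} {g : Perm α} (hg : g ∈ G) {x : α}
    (h : Linked G x (g x)) (k : ℤ) : Linked G x ((g ^ k) x) := by
  have key : ∀ n : ℕ, Linked G x ((g ^ n) x) := by
    intro n
    induction n with
    | zero => exact .refl _
    | succ n ih =>
      refine ih.trans ?_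
      rw [pow_succ, Perm.mul_apply]
      exact h.map (pow_mem hg n)
  obtain ⟨n, rfl | rfl⟩ := k.eq_nat_or_neg
  · rw [zpow_natCast]; exact key n
  · have := ((key n).map (inv_mem (pow_mem hg n))).symm
    rw [zpow_neg, zpow_natCast]
    simpa using this

/-- Let `γ = (a c a⁻¹) c⁻¹` where `c` is a cycle on a spread set `S`. The supports of `γ` and
`a² γ a⁻²` share the single point `a³ z`, so their commutator is a three-cycle. It links all
points of `S`, and then all points on infinite orbits of `a`. -/
theorem linked_of_isSpread {a c : Perm α} {E : Set α} {z : α} {S : Finset α}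
    {G : Subgroup (Perm α)} (hS : IsSpread a E z S) (hc : c.IsCycleOn (S : Set α))
    (hcS : ∀ x, x ∉ S → c x = x) (ha : a ∈ G) (hγ : a * c * a⁻¹ * c⁻¹ ∈ G)
    (hR : ∀ x, FreeAt a x → ∃ k : ℤ, (a ^ k) x ∈ S) {x : α} (hx : FreeAt a x) :
    Linked G ((a ^ (3 : ℤ)) z) x := by
  set γ := a * c * a⁻¹ * c⁻¹ with hγdef
  set x₀ := (a ^ (3 : ℤ)) z with hx₀
  have hx₀S : x₀ ∈ S := hS.mem_three
  have hzx : x₀ ≠ z := fun h => by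
    have := hS.free z hS.mem_zero 3 h
    omega
  have hnt : (S : Set α).Nontrivial := ⟨x₀, hx₀S, z, hS.mem_zero, hzx⟩
  have hcinv : c⁻¹.IsCycleOn (S : Set α) := hc.inv
  have hcS' : ∀ x, x ∉ S → c⁻¹ x = x := fun x hx => by
    rw [Perm.inv_eq_iff_eq, hcS x hx]
  have hcmem : ∀ s, s ∈ S → c s ∈ S := fun s hs => hc.apply_mem_iff.2 hs
  have hcmem' : ∀ s, s ∈ S → c⁻¹ s ∈ S := fun s hs => hcinv.apply_mem_iff.2 hs
  have a1 : ∀ y, (a ^ (1 : ℤ)) y = a y := fun y => by simp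
  have hone : ∀ s ∈ S, a⁻¹ s ∉ S := fun s hs h => hS.one _ h (by simpa using hs)
  have hone' : ∀ s ∈ S, a s ∉ S := fun s hs h => hS.one _ hs (by simpa using h)
  have hγS : ∀ s ∈ S, γ s = c⁻¹ s := by
    intro s hs
    simp only [hγdef, Perm.mul_apply]
    rw [hcS _ (hone _ (hcmem' s hs))]
    simp
  have hγmove : ∀ y, γ y ≠ y → y ∈ S ∨ a⁻¹ y ∈ S := by
    intro y hy
    by_contra! h
    apply hy
    simp only [hγdef, Perm.mul_apply]
    rw [hcS' y h.1, hcS _ h.2]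
    simp
  set γ' := a ^ (2 : ℤ) * γ * (a ^ (2 : ℤ))⁻¹ with hγ'def
  have hγ' : γ' ∈ G := mul_mem (mul_mem (zpow_mem ha 2) hγ) (inv_mem (zpow_mem ha 2))
  have hγ'x : γ' x₀ = (a ^ (3 : ℤ)) (c z) := by
    have h1 : (a ^ (2 : ℤ))⁻¹ x₀ = a z := by
      rw [hx₀, ← zpow_neg, zpow_apply_zpow_apply]; simp
    rw [hγ'def, Perm.mul_apply, Perm.mul_apply, h1, hγdef]
    simp only [Perm.mul_apply]
    rw [hcS' _ (hone' z hS.mem_zero), show a⁻¹ (a z) = z by simp, ← a1 (c z), zpow_apply_zpow_apply]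
    norm_num
  have hcz : c z ≠ z := hc.apply_ne hnt hS.mem_zero
  have h1 : γ x₀ ≠ x₀ := by
    rw [hγS x₀ hx₀S]; exact hcinv.apply_ne hnt hx₀S
  have h2 : γ' x₀ ≠ x₀ := by
    rw [hγ'x, hx₀]; simpa using hcz
  have h3 : γ x₀ ≠ γ' x₀ := by
    intro h
    rw [hγS x₀ hx₀S, hγ'x] at h
    exact hcz (hS.three _ (hcmem z hS.mem_zero) (h ▸ hcmem' x₀ hx₀S))
  have huniq : ∀ y, γ y ≠ y → γ' y ≠ y → y = x₀ := by
    intro y hy hy'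
    have hy2 : γ ((a ^ (2 : ℤ))⁻¹ y) ≠ (a ^ (2 : ℤ))⁻¹ y := by
      intro h
      apply hy'
      rw [hγ'def, Perm.mul_apply, Perm.mul_apply, h]
      simp
    obtain ⟨u, rfl⟩ : ∃ u, y = (a ^ (3 : ℤ)) u := ⟨(a ^ (3 : ℤ))⁻¹ y, by simp⟩
    have e1 : a⁻¹ ((a ^ (3 : ℤ)) u) = (a ^ (2 : ℤ)) u := by
      rw [← zpow_neg_one, zpow_apply_zpow_apply]; norm_num
    have e2 : (a ^ (2 : ℤ))⁻¹ ((a ^ (3 : ℤ)) u) = (a ^ (1 : ℤ)) u := by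
      rw [← zpow_neg, zpow_apply_zpow_apply]; norm_num
    have e3 : a⁻¹ ((a ^ (1 : ℤ)) u) = u := by simp
    have hm := hγmove _ hy
    have hm' := hγmove _ hy2
    rw [e1] at hm
    rw [e2, e3] at hm'
    rcases hm with hm | hm <;> rcases hm' with hm' | hm'
    · exact absurd (by rw [zpow_apply_zpow_apply]; exact hm) (hS.two _ hm')
    · rw [hS.three u hm' hm]
    · exact absurd (by rw [zpow_apply_zpow_apply]; exact hm) (hS.one _ hm')
    · exact absurd hm (hS.two _ hm')
  have hlink : Linked G x₀ (γ x₀) := by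
    refine Or.inr ⟨γ' x₀, h1.symm, h3, h2.symm, ?_⟩
    rw [← commutator_eq_threeCycle h1 h2 huniq]
    exact mul_mem (mul_mem (mul_mem hγ hγ') (inv_mem hγ)) (inv_mem hγ')
  have hlinkS : ∀ s ∈ S, Linked G x₀ s := by
    intro s hs
    obtain ⟨n, -, rfl⟩ := hcinv.exists_pow_eq hx₀S hs
    have h4 : ∀ n : ℕ, (c⁻¹ ^ n) x₀ ∈ S ∧ (γ ^ n) x₀ = (c⁻¹ ^ n) x₀ := by
      intro n
      induction n with
      | zero => exact ⟨hx₀S, rfl⟩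
      | succ n ih =>
        rw [pow_succ', pow_succ', Perm.mul_apply, Perm.mul_apply, ih.2]
        exact ⟨hcmem' _ ih.1, hγS _ ih.1⟩
    rw [← (h4 n).2, ← zpow_natCast]
    exact hlink.zpow hγ n
  have ha3 : Linked G x₀ ((a ^ (3 : ℤ)) x₀) :=
    ((hlinkS z hS.mem_zero).map (zpow_mem ha 3)).symm
  -- `a³` and `a⁴` preserve the class of `x₀`, hence so does `a`
  have ha4 : Linked G x₀ ((a ^ (4 : ℤ)) x₀) := by
    have := hlinkS _ hS.mem_seven
    rwa [hx₀, zpow_apply_zpow_apply]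
  clear_value x₀
  have ha1 : Linked G x₀ (a x₀) := by
    have h5 := (ha3.zpow (zpow_mem ha 3) (-1)).map (zpow_mem ha 4)
    rw [← zpow_mul, zpow_apply_zpow_apply] at h5
    have := ha4.trans h5
    rwa [show (4 : ℤ) + 3 * -1 = 1 by norm_num, a1] at this
  obtain ⟨k, hk⟩ := hR x hx
  have h6 := (hlinkS _ hk).map (zpow_mem ha (-k))
  rw [zpow_apply_zpow_apply] at h6
  simp only [neg_add_cancel, zpow_zero, Perm.one_apply] at h6
  exact (ha1.zpow ha (-k)).trans h6

variable [Infinite α]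

/-- The case of `exists_FAlt_le_closure` in which `b` moves all points on finite orbits of `a` to
points on infinite ones. -/
theorem exists_FAlt_le_closure_aux {a b : Perm α} (hF : {x | ¬ FreeAt a x}.Finite)
    {R : Finset α} (hR : ∀ x, ∃ k : ℤ, (a ^ k) x ∈ R)
    (hab : a * b * a⁻¹ * b⁻¹ ∈ FSym α) (hb : ∀ x, ¬ FreeAt a x → FreeAt a (b x)) :
    ∃ β ∈ FAlt α, FAlt α ≤ Subgroup.closure {a, β * b} := by
  set w := a * b * a⁻¹ * b⁻¹ with hw
  set E : Set α := {x | w x ≠ x} ∪ a ⁻¹' {x | w x ≠ x} with hEdef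
  have hE : E.Finite := by
    refine Set.Finite.union hab (Set.Finite.preimage a.injective.injOn hab)
  obtain ⟨m, hm, hwm⟩ := exists_pow_eq_one_of_mem_FSym hab
  obtain ⟨r, hr⟩ := hF.infinite_compl.nonempty
  obtain ⟨z, S₀, hS₀⟩ := exists_isSpread (not_not.1 hr : FreeAt a r) hE
  obtain ⟨S₁, hS₁, hRS₁⟩ := hS₀.exists_meets hE R
  -- `p > m` makes `p` prime to the order of `w`, and an odd `p` makes a `p`-cycle even
  obtain ⟨p, hpm, hp⟩ := Nat.exists_infinite_primes (S₁.card + m + 3)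
  obtain ⟨S, hSS, hS, hcard⟩ := hS₁.exists_card_eq hE (p - S₁.card)
  have hcard' : S.card = p := by omega
  obtain ⟨c, hc, hcsub⟩ := S.countable_toSet.exists_cycleOn
  have hcS : ∀ x, x ∉ S → c x = x := fun x hx => by
    by_contra h; exact hx (hcsub h)
  have hcp : c ^ p = 1 := by
    ext x
    by_cases hx : x ∈ S
    · rw [← hcard', hc.pow_card_apply hx]; rfl
    · exact Function.IsFixedPt.perm_pow (hcS x hx) p
  have hcF : c ∈ FSym α := S.finite_toSet.subset hcsub
  refine ⟨c, mem_FAlt_of_pow_eq_one hcF (hp.odd_of_ne_two (by omega)) hcp, ?_⟩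
  set G := Subgroup.closure {a, c * b} with hG
  have ha : a ∈ G := Subgroup.subset_closure (by simp)
  have hb' : c * b ∈ G := Subgroup.subset_closure (by simp)
  -- the cycle `c` and its conjugate `d` move neither each other's support nor that of `w`
  set d := a * c * a⁻¹ with hd
  have hdS : ∀ x, a⁻¹ x ∉ S → d x = x := fun x hx => by
    rw [hd, Perm.mul_apply, Perm.mul_apply, hcS _ hx]; simp
  have hcw : Commute c w := by
    refine Disjoint.commute fun x => ?_
    by_cases hx : x ∈ S
    · right
      by_contra h
      exact hS.notMem x hx (Or.inl h)
    · exact Or.inl (hcS x hx)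
  have hdw : Commute d w := by
    refine Disjoint.commute fun x => ?_
    by_cases hx : a⁻¹ x ∈ S
    · right
      by_contra h
      exact hS.notMem _ hx (Or.inr (by simpa using h))
    · exact Or.inl (hdS x hx)
  have hdc : Commute d c := by
    refine Disjoint.commute fun x => ?_
    by_cases hx : x ∈ S
    · exact Or.inl (hdS x fun h => hS.one _ h (by simpa using hx))
    · exact Or.inr (hcS x hx)
  have hdp : d ^ p = 1 := by rw [hd, conj_pow, hcp]; simp
  have hγp : (d * c⁻¹) ^ p = 1 := by
    rw [hdc.inv_right.mul_pow, hdp, inv_pow, hcp]; simp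
  have hwγ : Commute w (d * c⁻¹) := (hdw.symm).mul_right hcw.symm.inv_right
  have hf : w * (d * c⁻¹) ∈ G := by
    have h1 : a * (c * b) * a⁻¹ * (c * b)⁻¹ = w * (d * c⁻¹) := by
      have h2 : a * (c * b) * a⁻¹ * (c * b)⁻¹ = d * w * c⁻¹ := by
        rw [hd, hw]; group
      rw [h2, hdw.eq, mul_assoc]
    rw [← h1]
    exact mul_mem (mul_mem (mul_mem ha hb') (inv_mem ha)) (inv_mem hb')
  have hγ : d * c⁻¹ ∈ G := by
    have h1 : (d * c⁻¹) ^ m ∈ G := by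
      have := pow_mem hf m
      rwa [hwγ.mul_pow, hwm, one_mul] at this
    have hcop : Nat.Coprime m p :=
      (Nat.coprime_comm.1 ((Nat.Prime.coprime_iff_not_dvd hp).2
        fun h => by have := Nat.le_of_dvd hm h; omega))
    obtain ⟨u, v, huv⟩ := Nat.isCoprime_iff_coprime.2 hcop
    have h2 : d * c⁻¹ = ((d * c⁻¹) ^ m) ^ u := by
      calc d * c⁻¹ = (d * c⁻¹) ^ ((m : ℤ) * u + (p : ℤ) * v) := by
            rw [mul_comm (m : ℤ), mul_comm (p : ℤ), huv, zpow_one]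
        _ = ((d * c⁻¹) ^ m) ^ u := by
            rw [zpow_add, zpow_mul, zpow_mul, zpow_natCast, zpow_natCast, hγp, one_zpow, mul_one]
    rw [h2]
    exact zpow_mem h1 u
  have hlink : ∀ x, FreeAt a x → Linked G ((a ^ (3 : ℤ)) z) x := by
    intro x hx
    refine linked_of_isSpread hS hc hcS ha hγ (fun y hy => ?_) hx
    obtain ⟨k, hk⟩ := hR y
    obtain ⟨j, hj⟩ := hRS₁ _ hk (hy.zpow k)
    exact ⟨j + k, hSS (by rwa [← zpow_apply_zpow_apply])⟩
  have hcfree : ∀ x, FreeAt a x → FreeAt a (c x) := by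
    intro x hx
    by_cases hxS : x ∈ S
    · exact hS.free _ (hc.apply_mem_iff.2 hxS)
    · rwa [hcS x hxS]
  set x₀ := (a ^ (3 : ℤ)) z with hx₀
  -- only finitely many points are excluded, so some free point `y` is moved to a free point
  have hstab : Linked G x₀ ((c * b) x₀) := by
    obtain ⟨y, hy⟩ := (hF.union
      (hF.preimage (c * b).injective.injOn)).infinite_compl.nonempty
    simp only [Set.mem_compl_iff, Set.mem_union, Set.mem_preimage, not_or] at hy
    have h1 := hlink y (not_not.1 hy.1)
    have h2 := hlink _ (not_not.1 hy.2)
    exact h2.trans (h1.map hb').symm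
  have hall : ∀ x, Linked G x₀ x := by
    intro x
    by_cases hx : FreeAt a x
    · exact hlink x hx
    · have h1 := hlink ((c * b) x) (hcfree _ (hb x hx))
      have h2 := (hstab.symm.trans h1).map (inv_mem hb')
      simpa using h2
  exact FAlt_le_of_linked fun x y => (hall x).symm.trans (hall y)

/-- A finite set can be moved off another one by a finitary permutation. -/
theorem exists_mem_FSym_forall_notMem (A F : Finset α) :
    ∃ τ ∈ FSym α, ∀ x ∈ A, τ x ∉ F := by
  induction A using Finset.induction_on with
  | empty => exact ⟨1, one_mem _, by simp⟩
  | insert x A hx ih =>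
    obtain ⟨τ, hτ, hA⟩ := ih
    obtain ⟨y, hy⟩ := Infinite.exists_notMem_finset (F ∪ A.image τ)
    simp only [Finset.mem_union, Finset.mem_image, not_or, not_exists, not_and] at hy
    refine ⟨swap (τ x) y * τ, mul_mem (swap_mem_FSym _ _) hτ, fun t ht => ?_⟩
    rw [Perm.mul_apply]
    rcases Finset.mem_insert.1 ht with rfl | ht
    · rw [swap_apply_left]; exact hy.1
    · rw [swap_apply_of_ne_of_ne _ (hy.2 t ht)]
      · exact hA t ht
      · intro h
        exact hx (τ.injective h ▸ ht)

theorem exists_mem_FAlt_forall_notMem (A F : Finset α) :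
    ∃ τ ∈ FAlt α, ∀ x ∈ A, τ x ∉ F := by
  obtain ⟨τ, hτ, hA⟩ := exists_mem_FSym_forall_notMem A F
  rcases mem_FAlt_or_swap_mul_mem hτ with h | h
  · exact ⟨τ, h, hA⟩
  · obtain ⟨u, hu⟩ := Infinite.exists_notMem_finset F
    obtain ⟨v, hv⟩ := Infinite.exists_notMem_finset (insert u F)
    simp only [Finset.mem_insert, not_or] at hv
    refine ⟨swap u v * τ, h u v (Ne.symm hv.1), fun x hx => ?_⟩
    rw [Perm.mul_apply, swap_apply_def]
    split_ifs
    exacts [hv.2, hu, hA x hx]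

/-- If all but finitely many points lie on finitely many infinite orbits of `a`, and `b` commutes
with `a` up to a finitary permutation, then `a` and some element of the coset `FAlt α * b`
generate a group that contains `FAlt α`. -/
theorem exists_FAlt_le_closure {a b : Perm α} (hF : {x | ¬ FreeAt a x}.Finite)
    {R : Finset α} (hR : ∀ x, ∃ k : ℤ, (a ^ k) x ∈ R)
    (hab : a * b * a⁻¹ * b⁻¹ ∈ FSym α) :
    ∃ β ∈ FAlt α, FAlt α ≤ Subgroup.closure {a, β * b} := by
  obtain ⟨δ, hδ, hδF⟩ := exists_mem_FAlt_forall_notMem (hF.toFinset.image b) hF.toFinset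
  obtain ⟨β, hβ, h⟩ := exists_FAlt_le_closure_aux (a := a) (b := δ * b) hF hR
    (by
      have h1 : a * (δ * b) * a⁻¹ * (δ * b)⁻¹ = (a * δ * a⁻¹) * (a * b * a⁻¹ * b⁻¹) * δ⁻¹ := by
        group
      rw [h1]
      exact mul_mem (mul_mem (conj_mem_FSym a (FAlt_le_FSym hδ)) hab)
        (inv_mem (FAlt_le_FSym hδ)))
    (by
      intro x hx
      have := hδF (b x) (Finset.mem_image_of_mem b (by simpa using hx))
      simpa using this)
  exact ⟨β * δ, mul_mem hβ hδ, by rwa [mul_assoc]⟩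

end TwoGenerators

/-! ### Eventual translations of the rays -/

section Rays

theorem FreeAt.of_inv {α : Type*} {a : Perm α} {x : α} (h : FreeAt a⁻¹ x) : FreeAt a x := by
  intro k hk
  have h1 := h (-k) (by rwa [inv_zpow', neg_neg])
  omega

theorem EventuallyTranslates.zpow {n : ℕ} {σ : Perm (X n)} {t : Fin n → ℤ}
    (h : EventuallyTranslates σ t) (k : ℤ) : EventuallyTranslates (σ ^ k) (k • t) := by
  have key : ∀ m : ℕ, EventuallyTranslates (σ ^ m) ((m : ℤ) • t) := by
    intro m
    induction m with
    | zero => simpa using EventuallyTranslates.one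
    | succ m ih =>
      have := ih.mul h
      rw [← pow_succ] at this
      convert this using 1
      push_cast
      rw [add_smul, one_smul]
  obtain ⟨m, rfl | rfl⟩ := k.eq_nat_or_neg
  · rw [zpow_natCast]; exact key m
  · rw [zpow_neg, zpow_natCast, neg_smul]; exact (key m).inv

theorem finite_setOf_ray {n : ℕ} {p : X n → Prop}
    (h : ∀ i, ∃ N : ℕ, ∀ m, N ≤ m → ¬ p (i, m)) : {x | p x}.Finite := by
  choose N hN using h
  refine (Set.finite_iUnion fun i : Fin n => (Set.finite_Iio (N i)).image (Prod.mk i)).subset ?_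
  rintro ⟨i, m⟩ hx
  refine Set.mem_iUnion.2 ⟨i, m, ?_, rfl⟩
  by_contra hc
  exact hN i m (not_lt.1 hc) hx

theorem EventuallyTranslates.mem_FSym {n : ℕ} {σ : Perm (X n)}
    (h : EventuallyTranslates σ 0) : σ ∈ FSym (X n) := by
  refine finite_setOf_ray fun i => ?_
  obtain ⟨N, hN⟩ := h i
  refine ⟨N, fun m hm => ?_⟩
  rw [not_not]
  obtain ⟨h1, h2⟩ := hN m hm
  exact Prod.ext h1 (by simpa using h2)

theorem eventuallyTranslates_of_mem_FSym {n : ℕ} {σ : Perm (X n)} (h : σ ∈ FSym (X n)) :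
    EventuallyTranslates σ 0 := by
  intro i
  have h1 : {m : ℕ | σ (i, m) ≠ (i, m)}.Finite :=
    Set.Finite.preimage (Prod.mk_right_injective i).injOn h
  obtain ⟨N, hN⟩ := h1.bddAbove
  refine ⟨N + 1, fun m hm => ?_⟩
  have h2 : σ (i, m) = (i, m) := by
    by_contra hc
    have := hN hc
    omega
  simp [h2]

/-- If `τ` pushes the ray `i` outwards by `s > 0` from the `N`-th point on, then the points far out
lie on infinite orbits, and every point of the ray can be moved into its first `N + s` points. -/
theorem free_and_reduce_of_push {n : ℕ} {τ : Perm (X n)} {i : Fin n} {N s : ℕ} (hs : 0 < s)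
    (h : ∀ m, N ≤ m → τ (i, m) = (i, m + s)) :
    (∀ m, N ≤ m → FreeAt τ (i, m)) ∧
      ∀ m, ∃ k : ℤ, ∃ m' < N + s, (τ ^ k) (i, m) = (i, m') := by
  have hpow : ∀ k m : ℕ, N ≤ m → (τ ^ k) (i, m) = (i, m + k * s) := by
    intro k
    induction k with
    | zero => intro m _; simp
    | succ k ih =>
      intro m hm
      rw [pow_succ', Perm.mul_apply, ih m hm, h _ (by omega)]
      congr 1
      ring
  have hpos : ∀ k m : ℕ, N ≤ m → (τ ^ k) (i, m) = (i, m) → k = 0 := by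
    intro k m hm hk
    rw [hpow k m hm] at hk
    have h1 : m + k * s = m := (Prod.ext_iff.1 hk).2
    have h2 : k * s = 0 := by omega
    rcases Nat.mul_eq_zero.1 h2 with h3 | h3 <;> omega
  refine ⟨fun m hm k hk => ?_, fun m => ?_⟩
  · obtain ⟨j, rfl | rfl⟩ := k.eq_nat_or_neg
    · rw [zpow_natCast] at hk
      rw [hpos j m hm hk]; rfl
    · rw [zpow_neg, zpow_natCast, Perm.inv_eq_iff_eq] at hk
      rw [hpos j m hm hk.symm]; rfl
  · induction m using Nat.strong_induction_on with
    | _ m ih =>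
      by_cases hm : m < N + s
      · exact ⟨0, m, hm, rfl⟩
      · obtain ⟨k, m', hm', hk⟩ := ih (m - s) (by omega)
        refine ⟨k + (-1), m', hm', ?_⟩
        rw [← hk, zpow_add, Perm.mul_apply]
        congr 1
        rw [zpow_neg_one, Perm.inv_eq_iff_eq, h _ (by omega)]
        congr 1
        omega

/-- A permutation that translates all rays by nonzero lengths has finitely many points on finite
orbits, and finitely many orbits. -/
theorem EventuallyTranslates.finite_orbits {n : ℕ} {a : Perm (X n)} {t : Fin n → ℤ}
    (h : EventuallyTranslates a t) (ht : ∀ i, t i ≠ 0) :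
    {x | ¬ FreeAt a x}.Finite ∧ ∃ R : Finset (X n), ∀ x, ∃ k : ℤ, (a ^ k) x ∈ R := by
  have key : ∀ i, ∃ N : ℕ, (∀ m, N ≤ m → FreeAt a (i, m)) ∧
      ∀ m, ∃ k : ℤ, ∃ m' < N, (a ^ k) (i, m) = (i, m') := by
    intro i
    rcases lt_or_gt_of_ne (ht i) with hi | hi
    · obtain ⟨N, hN⟩ := h.inv i
      have hpush : ∀ m, N ≤ m → a⁻¹ (i, m) = (i, m + (-t i).toNat) := by
        intro m hm
        obtain ⟨h1, h2⟩ := hN m hm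
        refine Prod.ext h1 ?_
        simp only [Pi.neg_apply] at h2
        simp only
        omega
      obtain ⟨h1, h2⟩ := free_and_reduce_of_push (by omega) hpush
      refine ⟨N + (-t i).toNat, fun m hm => (h1 m (by omega)).of_inv, fun m => ?_⟩
      obtain ⟨k, m', hm', hk⟩ := h2 m
      exact ⟨-k, m', hm', by rwa [inv_zpow'] at hk⟩
    · obtain ⟨N, hN⟩ := h i
      have hpush : ∀ m, N ≤ m → a (i, m) = (i, m + (t i).toNat) := by
        intro m hm
        obtain ⟨h1, h2⟩ := hN m hm
        refine Prod.ext h1 ?_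
        simp only
        omega
      obtain ⟨h1, h2⟩ := free_and_reduce_of_push (by omega) hpush
      exact ⟨N + (t i).toNat, fun m hm => h1 m (by omega), h2⟩
  choose N hN hR using key
  refine ⟨finite_setOf_ray fun i => ⟨N i, fun m hm => not_not.2 (hN i m hm)⟩, ?_⟩
  have hfin : {x : X n | x.2 < N x.1}.Finite :=
    finite_setOf_ray fun i => ⟨N i, fun m hm => not_lt.2 hm⟩
  refine ⟨hfin.toFinset, fun ⟨i, m⟩ => ?_⟩
  obtain ⟨k, m', hm', hk⟩ := hR i m
  refine ⟨k, ?_⟩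
  rw [hk]
  simpa using hm'

/-- The permutations of `X n` that are eventually translations of the rays, with total translation
length zero. (The last condition holds automatically.) -/
def almostTranslations (n : ℕ) : Subgroup (Perm (X n)) where
  carrier := {σ | ∃ t, EventuallyTranslates σ t ∧ ∑ i, t i = 0}
  one_mem' := ⟨0, .one, by simp⟩
  mul_mem' := by
    rintro σ τ ⟨s, hs, hs0⟩ ⟨t, ht, ht0⟩
    exact ⟨s + t, hs.mul ht, by simp [Finset.sum_add_distrib, hs0, ht0]⟩
  inv_mem' := by
    rintro σ ⟨s, hs, hs0⟩
    exact ⟨-s, hs.inv, by simp [hs0]⟩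

theorem gen_mem_almostTranslations {n : ℕ} (k : Fin (n - 1)) : gen k ∈ almostTranslations n :=
  ⟨_, gen_eventuallyTranslates k, by simp⟩

theorem H_le_almostTranslations (n : ℕ) : H n ≤ almostTranslations n := by
  rw [H, Subgroup.closure_le]
  rintro _ ⟨k, rfl⟩
  exact gen_mem_almostTranslations k

theorem H₂_le_almostTranslations : H₂ ≤ almostTranslations 2 := by
  rw [H₂, Subgroup.closure_le]
  rintro _ (rfl | ⟨k, rfl⟩)
  · exact ⟨0, eventuallyTranslates_of_mem_FSym (swap_mem_FSym _ _), by simp⟩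
  · exact gen_mem_almostTranslations k

end Rays

/-! ### Finitary permutations in the Houghton groups and in their subgroups of finite index -/

section FiniteIndex

theorem gen_apply_ray₁ {n : ℕ} (k : Fin (n - 1)) (m : ℕ) :
    gen k (ray₁ k, m) = (ray₁ k, m + 1) := by
  simp [gen]

theorem gen_apply_ray_zero {n : ℕ} (k : Fin (n - 1)) : gen k (ray k, 0) = (ray₁ k, 0) := by
  simp [gen, (ray₁_ne_ray k k).symm]

theorem gen_apply_ray_succ {n : ℕ} (k : Fin (n - 1)) (m : ℕ) :
    gen k (ray k, m + 1) = (ray k, m) := by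
  simp [gen, (ray₁_ne_ray k k).symm]

theorem gen_apply_of_ne {n : ℕ} (k : Fin (n - 1)) {i : Fin n} (h : i ≠ ray₁ k) (h' : i ≠ ray k)
    (m : ℕ) : gen k (i, m) = (i, m) := by
  simp [gen, h, h']

theorem ray₁_eq {n : ℕ} (k l : Fin (n - 1)) : ray₁ k = ray₁ l := rfl

theorem eq_ray₁_or_exists_ray {n : ℕ} (k : Fin (n - 1)) (i : Fin n) :
    i = ray₁ k ∨ ∃ l, i = ray l := by
  obtain ⟨i, hi⟩ := i
  rcases i with _ | i
  · exact Or.inl rfl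
  · exact Or.inr ⟨⟨i, by omega⟩, rfl⟩

theorem FSym_le_of_gen_mem {n : ℕ} (k₀ : Fin (n - 1)) {K : Subgroup (Perm (X n))}
    (hgen : ∀ k, gen k ∈ K) (hswap : swap (ray₁ k₀, 0) (ray₁ k₀, 1) ∈ K) : FSym (X n) ≤ K := by
  have hconj : ∀ g ∈ K, ∀ x y, swap x y ∈ K → swap (g x) (g y) ∈ K := by
    intro g hg x y h
    rw [swap_apply_apply]
    exact mul_mem (mul_mem hg h) (inv_mem hg)
  have h1 : ∀ m, swap (ray₁ k₀, m) (ray₁ k₀, m + 1) ∈ K := by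
    intro m
    induction m with
    | zero => exact hswap
    | succ m ih =>
      have := hconj _ (hgen k₀) _ _ ih
      rwa [gen_apply_ray₁, gen_apply_ray₁] at this
  have h2 : ∀ m, swap (ray₁ k₀, 0) (ray₁ k₀, m) ∈ K := by
    intro m
    induction m with
    | zero => rw [swap_self]; exact one_mem K
    | succ m ih => exact SubmonoidClass.swap_mem_trans K ih (h1 m)
  have h3 : ∀ k m, swap (ray₁ k₀, 0) (ray k, m) ∈ K := by
    intro k m
    have hpow : (gen k ^ (m + 1)) (ray k, m) = (ray₁ k₀, 0) := by
      induction m with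
      | zero => rw [pow_succ, pow_zero, one_mul, gen_apply_ray_zero]; rfl
      | succ m ih => rw [pow_succ, Perm.mul_apply, gen_apply_ray_succ, ih]
    have hpow' : ∀ j m : ℕ, (gen k ^ j) (ray₁ k₀, m) = (ray₁ k₀, m + j) := by
      intro j
      induction j with
      | zero => intro m; rfl
      | succ j ih =>
        intro m
        rw [pow_succ, Perm.mul_apply, ray₁_eq k₀ k, gen_apply_ray₁, ray₁_eq k k₀, ih]
        congr 1
        ring
    have h4 := hconj _ (inv_mem (pow_mem (hgen k) (m + 1))) _ _
      (SubmonoidClass.swap_mem_trans K (by rw [swap_comm]; exact h2 (0 + (m + 1)))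
        (h2 0) : swap (ray₁ k₀, 0 + (m + 1)) (ray₁ k₀, 0) ∈ K)
    rwa [Perm.inv_eq_iff_eq.2 (hpow' (m + 1) 0).symm, Perm.inv_eq_iff_eq.2 hpow.symm] at h4
  have h5 : ∀ x, swap (ray₁ k₀, 0) x ∈ K := by
    rintro ⟨i, m⟩
    rcases eq_ray₁_or_exists_ray k₀ i with rfl | ⟨k, rfl⟩
    exacts [h2 m, h3 k m]
  rw [← closure_isSwap, Subgroup.closure_le]
  rintro _ ⟨x, y, -, rfl⟩
  exact SubmonoidClass.swap_mem_trans K (by rw [swap_comm]; exact h5 x) (h5 y)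

/-- The commutator of two different generators is the transposition of the first two points of the
first ray. -/
theorem gen_commutator {n : ℕ} {j k : Fin (n - 1)} (hjk : j ≠ k) :
    gen j * gen k = swap (ray₁ k, 0) (ray₁ k, 1) * (gen k * gen j) := by
  have hr : ray j ≠ ray k := fun h => hjk (by
    simp only [ray, Fin.mk.injEq] at h; exact Fin.ext (by omega))
  have e : ray₁ j = ray₁ k := rfl
  have nj := (ray₁_ne_ray j k)
  have nk := (ray₁_ne_ray k k)
  ext1 ⟨i, m⟩
  simp only [Perm.mul_apply]
  by_cases hi : i = ray₁ k
  · subst hi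
    rw [gen_apply_ray₁, ← e, gen_apply_ray₁, gen_apply_ray₁, e, gen_apply_ray₁,
      swap_apply_of_ne_of_ne] <;> simp
  by_cases hk : i = ray k
  · subst hk
    rw [gen_apply_of_ne j nk.symm hr.symm]
    rcases m with _ | m
    · rw [gen_apply_ray_zero, ← e, gen_apply_ray₁, swap_apply_left]
    · rw [gen_apply_ray_succ, gen_apply_of_ne j nk.symm hr.symm, swap_apply_of_ne_of_ne] <;>
        simp [nk.symm]
  by_cases hj : i = ray j
  · subst hj
    rw [gen_apply_of_ne k nj.symm hr]
    rcases m with _ | m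
    · rw [gen_apply_ray_zero, e, gen_apply_ray₁, swap_apply_right]
    · rw [gen_apply_ray_succ, gen_apply_of_ne k nj.symm hr, swap_apply_of_ne_of_ne] <;>
        simp [nj.symm]
  · rw [gen_apply_of_ne k hi hk, gen_apply_of_ne j hi hj, gen_apply_of_ne k hi hk,
      swap_apply_of_ne_of_ne] <;> simp [hi]

theorem FSym_le_H {n : ℕ} (hn : 3 ≤ n) : FSym (X n) ≤ H n := by
  have hgen : ∀ k, gen k ∈ H n := fun k => Subgroup.subset_closure ⟨k, rfl⟩
  have h01 : (⟨0, by omega⟩ : Fin (n - 1)) ≠ ⟨1, by omega⟩ := by simp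
  refine FSym_le_of_gen_mem ⟨1, by omega⟩ hgen ?_
  rw [← mul_inv_eq_of_eq_mul (gen_commutator h01)]
  exact mul_mem (mul_mem (hgen _) (hgen _)) (inv_mem (mul_mem (hgen _) (hgen _)))

theorem FSym_le_H₂ : FSym (X 2) ≤ H₂ :=
  FSym_le_of_gen_mem (n := 2) 0 (fun k => Subgroup.subset_closure (Or.inr ⟨k, rfl⟩))
    (Subgroup.subset_closure (Or.inl rfl))

/-- Among the transpositions `(x p)` with `p` ranging over an infinite set, two lie in the same
coset of the normal core; their quotient is a three-cycle, and all three-cycles are conjugate. -/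
theorem FAlt_le_of_finiteIndex {α : Type*} [DecidableEq α] [Infinite α]
    {K : Subgroup (Perm α)} (hK : FSym α ≤ K) (U : Subgroup K) [U.FiniteIndex] :
    FAlt α ≤ U.map K.subtype := by
  refine le_trans ?_ (Subgroup.map_mono U.normalCore_le)
  set N := U.normalCore with hN
  refine FAlt_le fun x y z hxy hyz hxz => ?_
  have hinf : Infinite {p // p ∉ ({x, y, z} : Set α)} :=
    (Set.Finite.infinite_compl (by simp)).to_subtype
  obtain ⟨⟨p, hp⟩, ⟨q, hq⟩, hpq, h⟩ := Finite.exists_ne_map_eq_of_infinite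
    fun p : {p // p ∉ ({x, y, z} : Set α)} =>
      ((⟨swap x p, hK (swap_mem_FSym x p)⟩ : K) : K ⧸ N)
  rw [QuotientGroup.eq] at h
  simp only [Set.mem_insert_iff, Set.mem_singleton_iff, not_or] at hp hq
  have hpq' : p ≠ q := fun h => hpq (Subtype.ext h)
  have hcyc : (⟨swap p x, hK (swap_mem_FSym p x)⟩ * ⟨swap x q, hK (swap_mem_FSym x q)⟩ : K) ∈ N := by
    convert h using 2
    rw [eq_inv_iff_mul_eq_one]
    ext1
    simp [swap_comm p x]
  set σ : Perm α := swap q z * swap p y with hσ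
  have hσF : σ ∈ FSym α := mul_mem (swap_mem_FSym _ _) (swap_mem_FSym _ _)
  have hσp : σ p = y := by
    rw [hσ, Perm.mul_apply, swap_apply_left, swap_apply_of_ne_of_ne (Ne.symm hq.2.1) hyz]
  have hσx : σ x = x := by
    rw [hσ, Perm.mul_apply, swap_apply_of_ne_of_ne (Ne.symm hp.1) hxy,
      swap_apply_of_ne_of_ne (Ne.symm hq.1) hxz]
  have hσq : σ q = z := by
    rw [hσ, Perm.mul_apply, swap_apply_of_ne_of_ne hpq'.symm hq.2.1, swap_apply_left]
  have hconj : threeCycle y x z ∈ N.map K.subtype := by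
    have h1 : threeCycle y x z = σ * threeCycle p x q * σ⁻¹ := by
      rw [conj_threeCycle, hσp, hσx, hσq]
    rw [h1]
    exact ⟨_, U.normalCore_normal.conj_mem _ hcyc ⟨σ, hK hσF⟩, rfl⟩
  exact threeCycle_mem_flip hxy.symm hxz hyz hconj

end FiniteIndex

/-! ### Generators of subgroups -/

section Rank

variable {G : Type*} [Group G]

theorem rank_le_of_closure_range_eq {ι : Type*} [Finite ι] {U : Subgroup G} [Group.FG U]
    (u : ι → G) (h : Subgroup.closure (Set.range u) = U) : Group.rank U ≤ Nat.card ι := by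
  subst h
  exact (Subgroup.rank_closure_finite_le_nat_card _).trans (Finite.card_range_le u)

theorem exists_closure_range_eq (U : Subgroup G) [Group.FG U] :
    ∃ s : Fin (Group.rank U) → G, Subgroup.closure (Set.range s) = U := by
  obtain ⟨S, hS, hcl⟩ := Group.rank_spec U
  refine ⟨fun i => ((S.equivFinOfCardEq hS).symm i : U), ?_⟩
  have h1 : Set.range (fun i => (((S.equivFinOfCardEq hS).symm i : U) : G)) =
      U.subtype '' (S : Set U) := by
    ext x
    constructor
    · rintro ⟨i, rfl⟩
      exact ⟨_, ((S.equivFinOfCardEq hS).symm i).2, rfl⟩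
    · rintro ⟨y, hy, rfl⟩
      exact ⟨S.equivFinOfCardEq hS ⟨y, hy⟩, by simp⟩
  rw [h1, ← MonoidHom.map_closure, hcl]
  ext x; simp

theorem two_le_rank {U : Subgroup G} [Group.FG U] {x y : G} (hx : x ∈ U) (hy : y ∈ U)
    (h : ¬ Commute x y) : 2 ≤ Group.rank U := by
  by_contra! hlt
  obtain ⟨s, hs⟩ := exists_closure_range_eq U
  refine h ?_
  obtain ⟨g, hg⟩ : ∃ g, ∀ i, s i = g := by
    by_cases h0 : Group.rank U = 0
    · exact ⟨1, fun i => absurd i.2 (by omega)⟩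
    · refine ⟨s ⟨0, by omega⟩, fun i => ?_⟩
      congr 1
      ext1
      have := i.2
      omega
  have hle : U ≤ Subgroup.zpowers g := by
    rw [← hs, Subgroup.closure_le]
    rintro _ ⟨i, rfl⟩
    rw [hg i]
    exact Subgroup.mem_zpowers g
  obtain ⟨i, rfl⟩ := hle hx
  obtain ⟨j, rfl⟩ := hle hy
  exact (Commute.refl g).zpow_zpow i j

end Rank

/-! ### The second Houghton group -/

section SecondHoughtonGroup

theorem not_commute_threeCycle {α : Type*} [DecidableEq α] {a b c d : α} (hab : a ≠ b)
    (hac : a ≠ c) (hbc : b ≠ c) (had : a ≠ d) (hbd : b ≠ d) (hcd : c ≠ d) :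
    ¬ Commute (threeCycle a b c) (threeCycle a b d) := by
  intro h
  have h1 := Equiv.congr_fun h.eq a
  rw [Perm.mul_apply, Perm.mul_apply, threeCycle_apply_fst hab had, threeCycle_apply_fst hab hac,
    threeCycle_apply_snd hbc hac, threeCycle_apply_snd hbd had] at h1
  exact hcd h1

/-- A subgroup of `H₂` that contains `FAlt (X 2)` and a nontrivial power of the translation is
generated by an element `a` of minimal positive translation length and a finitary element. -/
theorem exists_closure_pair_eq {V : Subgroup (Perm (X 2))} (hV : V ≤ H₂)
    (hA : FAlt (X 2) ≤ V) (hgen : ∃ m : ℕ, 0 < m ∧ gen (n := 2) 0 ^ m ∈ V) :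
    ∃ x y, Subgroup.closure {x, y} = V := by
  classical
  let P : ℕ → Prop := fun d => 0 < d ∧ ∃ x ∈ V, ∃ t : Fin 2 → ℤ, EventuallyTranslates x t ∧
    ∑ i, t i = 0 ∧ t 0 = d
  have hP : ∃ d, P d := by
    obtain ⟨m, hm, hmV⟩ := hgen
    refine ⟨m, hm, _, hmV, (m : ℤ) • (Pi.single (ray₁ 0) 1 - Pi.single (ray 0) 1), ?_, ?_, ?_⟩
    · rw [← zpow_natCast]
      exact (gen_eventuallyTranslates (n := 2) 0).zpow m
    · simp [ray₁, ray]
    · simp [ray₁, ray]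
  obtain ⟨hd, a, haV, t, hat, hsum, ht0⟩ := Nat.find_spec hP
  have hmin := fun m => Nat.find_min (m := m) hP
  set d := Nat.find hP with hddef
  clear_value d
  rw [Fin.sum_univ_two] at hsum
  have htne : ∀ i, t i ≠ 0 := by
    intro i
    fin_cases i <;> simp only [Fin.mk_zero, Fin.mk_one] <;> omega
  -- by minimality of `d`, the group `V` consists of the products of finitary permutations
  -- with powers of `a`
  have hdecomp : ∀ x ∈ V, ∃ k : ℤ, x * a ^ k ∈ FSym (X 2) := by
    intro x hx
    obtain ⟨s, hs, hs0⟩ := H₂_le_almostTranslations (hV hx)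
    rw [Fin.sum_univ_two] at hs0
    refine ⟨-(s 0 / d), ?_⟩
    have h1 := hs.mul (hat.zpow (-(s 0 / d)))
    have h2 : (s + (-(s 0 / (d : ℤ))) • t) 0 = s 0 % d := by
      simp only [Pi.add_apply, Pi.smul_apply, ht0, smul_eq_mul]
      have := Int.emod_add_mul_ediv (s 0) d
      linarith
    have h3 : (s + (-(s 0 / (d : ℤ))) • t) 1 = -(s 0 % d) := by
      rw [← h2]
      simp only [Pi.add_apply, Pi.smul_apply, smul_eq_mul]
      have e1 : s 1 = - s 0 := by omega
      have e2 : t 1 = - t 0 := by omega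
      rw [e1, e2]; ring
    have h4 : s 0 % d = 0 := by
      by_contra hne
      have hpos := Int.emod_nonneg (s 0) (b := d) (by omega)
      have hlt := Int.emod_lt_of_pos (s 0) (b := d) (by omega)
      refine hmin (s 0 % d).toNat (by omega) ⟨by omega, _, mul_mem hx (zpow_mem haV _), _, h1, ?_, ?_⟩
      · rw [Fin.sum_univ_two, h2, h3]; ring
      · rw [h2]; omega
    have h5 : s + (-(s 0 / (d : ℤ))) • t = 0 := by
      funext i
      fin_cases i
      · exact h2.trans h4
      · exact h3.trans (by rw [h4]; rfl)
    rw [h5] at h1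
    exact h1.mem_FSym
  obtain ⟨b, hbV, hbF, hb⟩ : ∃ b ∈ V, b ∈ FSym (X 2) ∧
      (b ∈ FAlt (X 2) → ∀ x ∈ V, x ∈ FSym (X 2) → x ∈ FAlt (X 2)) := by
    by_cases h : ∃ b ∈ V, b ∈ FSym (X 2) ∧ b ∉ FAlt (X 2)
    · obtain ⟨b, h1, h2, h3⟩ := h
      exact ⟨b, h1, h2, fun h4 => absurd h4 h3⟩
    · push Not at h
      exact ⟨1, one_mem _, one_mem _, fun _ => h⟩
  obtain ⟨hfin, R, hR⟩ := hat.finite_orbits htne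
  obtain ⟨β, hβ, hle⟩ := exists_FAlt_le_closure hfin hR
    (mul_mem (conj_mem_FSym a hbF) (inv_mem hbF))
  refine ⟨a, β * b, le_antisymm ?_ ?_⟩
  · rw [Subgroup.closure_le]
    rintro _ (rfl | rfl)
    exacts [haV, mul_mem (hA hβ) hbV]
  · set K := Subgroup.closure {a, β * b} with hK
    have haK : a ∈ K := Subgroup.subset_closure (by simp)
    have hbK : b ∈ K := by
      have h1 : β * b ∈ K := Subgroup.subset_closure (by simp)
      simpa using mul_mem (inv_mem (hle hβ)) h1
    have hfinK : ∀ x ∈ V, x ∈ FSym (X 2) → x ∈ K := by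
      intro x hx hxF
      by_cases hbA : b ∈ FAlt (X 2)
      · exact hle (hb hbA x hx hxF)
      · exact FSym_le_of_FAlt_le hle hbF hbA hbK hxF
    intro x hx
    obtain ⟨k, hk⟩ := hdecomp x hx
    have h1 := hfinK _ (mul_mem hx (zpow_mem haV k)) hk
    simpa using mul_mem h1 (inv_mem (zpow_mem haK k))

theorem rank_eq_two_of_finiteIndex (U : Subgroup H₂) [U.FiniteIndex] : Group.rank U = 2 := by
  have hA := FAlt_le_of_finiteIndex FSym_le_H₂ U
  refine le_antisymm ?_ ?_
  · obtain ⟨m, hm, -, hmU⟩ := Subgroup.exists_pow_mem_of_index_ne_zero (H := U)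
      Subgroup.FiniteIndex.index_ne_zero
      (⟨gen (n := 2) 0, Subgroup.subset_closure (Or.inr ⟨0, rfl⟩)⟩ : H₂)
    obtain ⟨x, y, hxy⟩ := exists_closure_pair_eq (V := U.map H₂.subtype)
      (by rintro _ ⟨x, -, rfl⟩; exact x.2) hA ⟨m, hm, ⟨_, hmU, rfl⟩⟩
    have e : U ≃* U.map H₂.subtype :=
      U.equivMapOfInjective H₂.subtype H₂.subtype_injective
    have : Group.FG (U.map H₂.subtype) := Group.fg_of_surjective (f := e.toMonoidHom) e.surjective
    rw [Group.rank_congr e]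
    have h2 := rank_le_of_closure_range_eq (U := U.map H₂.subtype) ![x, y]
      (by rw [← hxy]; simp [Set.pair_comm])
    simpa using h2
  · have mem : ∀ {a b c : X 2}, a ≠ b → b ≠ c → a ≠ c →
        ∃ h : threeCycle a b c ∈ H₂, (⟨threeCycle a b c, h⟩ : H₂) ∈ U := by
      intro a b c hab hbc hac
      obtain ⟨x, hx, hxe⟩ := hA (threeCycle_mem_FAlt hab hbc hac)
      rw [← hxe]
      exact ⟨x.2, hx⟩
    obtain ⟨h1, h1'⟩ := mem (a := (0, 0)) (b := (0, 1)) (c := (0, 2)) (by simp) (by simp) (by simp)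
    obtain ⟨h2, h2'⟩ := mem (a := (0, 0)) (b := (0, 1)) (c := (0, 3)) (by simp) (by simp) (by simp)
    refine two_le_rank h1' h2' fun h => ?_
    exact not_commute_threeCycle (a := ((0, 0) : X 2)) (b := (0, 1)) (c := (0, 2)) (d := (0, 3))
      (by simp) (by simp) (by simp) (by simp) (by simp) (by simp)
      (congrArg Subtype.val h.eq)

theorem rank_H₂ : Group.rank H₂ = 2 := by
  exact (Group.rank_congr Subgroup.topEquiv.symm).trans (rank_eq_two_of_finiteIndex ⊤)

end SecondHoughtonGroup

/-! ### Permutations modulo the finitary alternating group -/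

section Quotient

variable {α : Type*} [DecidableEq α]

instance FAlt_normal : (FAlt α).Normal := ⟨fun _ h g => conj_mem_FAlt g h⟩

/-- The projection of the symmetric group onto its quotient by the finitary alternating group. -/
abbrev modFAlt : Perm α →* Perm α ⧸ FAlt α := QuotientGroup.mk' (FAlt α)

theorem modFAlt_eq_one {σ : Perm α} : modFAlt σ = 1 ↔ σ ∈ FAlt α :=
  QuotientGroup.eq_one_iff σ

/-- Finitary permutations are central modulo the even ones. -/
theorem commute_modFAlt [Nontrivial α] {f : Perm α} (hf : f ∈ FSym α) (y : Perm α) :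
    Commute (modFAlt f) (modFAlt y) := by
  have h : (y⁻¹ * f⁻¹ * y⁻¹⁻¹) * f ∈ FAlt α := by
    by_cases hfA : f ∈ FAlt α
    · exact mul_mem (conj_mem_FAlt _ (inv_mem hfA)) hfA
    · refine mul_mem_FAlt_of_odd (conj_mem_FSym _ (inv_mem hf)) (fun h => hfA ?_) hf hfA
      have := inv_mem (conj_mem_FAlt y h)
      simpa [mul_assoc] using this
  change modFAlt f * modFAlt y = modFAlt y * modFAlt f
  rw [← map_mul, ← map_mul]
  refine QuotientGroup.eq.2 ?_
  convert h using 1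
  group

end Quotient

/-! ### The lattice of translation lengths -/

section Lattice

variable {n : ℕ}

theorem sum_transl (σ : H n) : ∑ i, transl σ i = 0 := by
  obtain ⟨t, ht, ht0⟩ := H_le_almostTranslations n σ.2
  rw [(transl_spec σ).unique ht, ht0]

theorem transl_ray (σ : H n) (k : Fin (n - 1)) : transl σ (ray k) = -(π n σ).toAdd k := by
  change _ = - -transl σ (ray k)
  rw [neg_neg]

theorem transl_ray₁ (σ : H n) (k : Fin (n - 1)) : transl σ (ray₁ k) = ∑ l, (π n σ).toAdd l := by
  have h := sum_transl σ
  rcases n with _ | n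
  · exact absurd k.2 (by omega)
  rw [Fin.sum_univ_succ] at h
  have h1 : ∑ l : Fin n, transl σ l.succ = -∑ l : Fin n, (π (n + 1) σ).toAdd l := by
    rw [← Finset.sum_neg_distrib]
    exact Finset.sum_congr rfl fun l _ => transl_ray (n := n + 1) σ l
  rw [h1] at h
  change transl σ 0 = ∑ l : Fin n, (π (n + 1) σ).toAdd l
  linarith

theorem mem_FSym_iff (hn : 3 ≤ n) {σ : H n} : (σ : Perm (X n)) ∈ FSym (X n) ↔ π n σ = 1 := by
  constructor
  · intro h
    have h1 := (transl_spec σ).unique (eventuallyTranslates_of_mem_FSym h)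
    apply Multiplicative.toAdd.injective
    funext k
    have := transl_ray σ k
    rw [h1] at this
    simpa using this.symm
  · intro h
    have h1 : transl σ = 0 := by
      funext i
      rcases eq_ray₁_or_exists_ray (⟨0, by omega⟩ : Fin (n - 1)) i with rfl | ⟨k, rfl⟩
      · rw [transl_ray₁, h]; simp
      · rw [transl_ray, h]; simp
    have h2 := transl_spec σ
    rw [h1] at h2
    exact h2.mem_FSym

/-- The image of a subgroup of `H n` under `π`, as a submodule of `ℤ^(n-1)`. -/
noncomputable def lattice (U : Subgroup (H n)) : Submodule ℤ (Fin (n - 1) → ℤ) :=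
  AddSubgroup.toIntSubmodule (Subgroup.toAddSubgroup' (U.map (π n)))

theorem mem_lattice {U : Subgroup (H n)} {v : Fin (n - 1) → ℤ} :
    v ∈ lattice U ↔ ∃ x ∈ U, π n x = Multiplicative.ofAdd v := Iff.rfl

theorem lattice_closure_range {ι : Type*} (u : ι → H n) :
    lattice (Subgroup.closure (Set.range u)) =
      Submodule.span ℤ (Set.range fun j => (π n (u j)).toAdd) := by
  apply le_antisymm
  · rintro v ⟨x, hx, hxv⟩
    obtain rfl : (π n x).toAdd = v := by rw [hxv]; rfl
    clear hxv
    induction hx using Subgroup.closure_induction with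
    | mem x hx => obtain ⟨j, rfl⟩ := hx; exact Submodule.subset_span ⟨j, rfl⟩
    | one => rw [map_one]; exact zero_mem _
    | mul x y _ _ hx hy => rw [map_mul]; exact add_mem hx hy
    | inv x _ hx => rw [map_inv]; exact neg_mem hx
  · rw [Submodule.span_le]
    rintro _ ⟨j, rfl⟩
    exact ⟨u j, Subgroup.subset_closure ⟨j, rfl⟩, rfl⟩

theorem exists_smul_single_mem_lattice (U : Subgroup (H n)) [U.FiniteIndex] :
    ∃ m : ℕ, m ≠ 0 ∧ ∀ k, (m : ℤ) • (Pi.single k 1 : Fin (n - 1) → ℤ) ∈ lattice U := by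
  refine ⟨U.normalCore.index, Subgroup.FiniteIndex.index_ne_zero, fun k => ?_⟩
  refine ⟨genH k ^ U.normalCore.index,
    U.normalCore_le (Subgroup.pow_index_mem U.normalCore (genH k)), ?_⟩
  rw [map_pow, π_gen, ← ofAdd_nsmul, natCast_zsmul]
  rfl

theorem finrank_lattice (U : Subgroup (H n)) [U.FiniteIndex] :
    Module.finrank ℤ (lattice U) = n - 1 := by
  obtain ⟨m, hm, hmU⟩ := exists_smul_single_mem_lattice U
  refine le_antisymm ((Submodule.finrank_le _).trans (by simp)) ?_
  have hall : ∀ v : Fin (n - 1) → ℤ, ((m : ℤ) • LinearMap.id (R := ℤ)) v ∈ lattice U := by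
    have h : (⊤ : Submodule ℤ (Fin (n - 1) → ℤ)) ≤
        (lattice U).comap ((m : ℤ) • LinearMap.id (R := ℤ)) := by
      rw [← (Pi.basisFun ℤ (Fin (n - 1))).span_eq, Submodule.span_le]
      rintro _ ⟨k, rfl⟩
      simpa using hmU k
    exact fun v => h trivial
  have hinj : Function.Injective
      (LinearMap.codRestrict (lattice U) ((m : ℤ) • LinearMap.id (R := ℤ)) hall) := by
    intro v w hvw
    have h1 : (m : ℤ) • v = (m : ℤ) • w := congrArg Subtype.val hvw
    exact smul_right_injective _ (by exact_mod_cast hm) h1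
  have h2 := LinearMap.finrank_le_finrank_of_injective hinj
  simpa using h2

theorem le_rank (U : Subgroup (H n)) [U.FiniteIndex] : n - 1 ≤ Group.rank U := by
  obtain ⟨s, hs⟩ := exists_closure_range_eq U
  rw [← finrank_lattice U]
  conv_lhs => rw [← hs, lattice_closure_range]
  exact (finrank_range_le_card _).trans_eq (by simp)

theorem rank_H (n : ℕ) : Group.rank (H n) = n - 1 := by
  refine le_antisymm ?_ ?_
  · have := rank_le_of_closure_range_eq (U := H n) (gen (n := n)) rfl
    simpa using this
  · exact (le_rank ⊤).trans_eq (Group.rank_congr Subgroup.topEquiv)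

/-- A finite family can be changed, without changing its span, so that its first member is not
killed by any of finitely many functionals that do not vanish on the span. The first member
becomes `∑ K ^ j • v j`, where `K` is not a root of any of the polynomials `∑ ℓ (v j) X ^ j`. -/
theorem exists_span_eq_forall_ne_zero {M : Type*} [AddCommGroup M] {r : ℕ} {i₀ : Fin r}
    (hi₀ : (i₀ : ℕ) = 0) {ι : Type*} [Fintype ι] (ℓ : ι → M →ₗ[ℤ] ℤ) (v : Fin r → M)
    (h : ∀ i, ∃ j, ℓ i (v j) ≠ 0) :
    ∃ w : Fin r → M, Submodule.span ℤ (Set.range w) = Submodule.span ℤ (Set.range v) ∧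
      ∀ i, ℓ i (w i₀) ≠ 0 := by
  classical
  let p : ι → Polynomial ℤ := fun i =>
    ∑ j : Fin r, Polynomial.C (ℓ i (v j)) * Polynomial.X ^ (j : ℕ)
  have hp : ∀ i, p i ≠ 0 := by
    intro i hi
    obtain ⟨j, hj⟩ := h i
    apply hj
    have h1 : (p i).coeff j = ℓ i (v j) := by
      simp only [p, Polynomial.finsetSum_coeff, Polynomial.coeff_C_mul_X_pow]
      rw [Finset.sum_eq_single j]
      · simp
      · intro l _ hl
        rw [if_neg fun hc => hl (Fin.ext hc.symm)]
      · simp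
    rw [← h1, hi, Polynomial.coeff_zero]
  obtain ⟨K, hK⟩ : ∃ K : ℤ, (∏ i, p i).eval K ≠ 0 := by
    by_contra! hc
    exact Finset.prod_ne_zero_iff.2 (fun i _ => hp i) (Polynomial.funext (by simpa using hc))
  rw [Polynomial.eval_prod, Finset.prod_ne_zero_iff] at hK
  set w₀ : M := ∑ j : Fin r, (K ^ (j : ℕ)) • v j with hw₀
  have hw₀' : w₀ = v i₀ + ∑ j ∈ Finset.univ.erase i₀, (K ^ (j : ℕ)) • v j := by
    rw [hw₀, ← Finset.add_sum_erase _ _ (Finset.mem_univ i₀), hi₀, pow_zero, one_smul]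
  refine ⟨Function.update v i₀ w₀, le_antisymm ?_ ?_, fun i => ?_⟩
  · rw [Submodule.span_le]
    rintro _ ⟨j, rfl⟩
    by_cases hj : j = i₀
    · subst hj
      rw [Function.update_self]
      exact sum_mem fun j _ => Submodule.smul_mem _ _ (Submodule.subset_span ⟨j, rfl⟩)
    · rw [Function.update_of_ne hj]
      exact Submodule.subset_span ⟨j, rfl⟩
  · have hother : ∀ j, j ≠ i₀ →
        v j ∈ Submodule.span ℤ (Set.range (Function.update v i₀ w₀)) := fun j hj =>
      Submodule.subset_span ⟨j, Function.update_of_ne hj _ _⟩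
    rw [Submodule.span_le]
    rintro _ ⟨j, rfl⟩
    by_cases hj : j = i₀
    · subst hj
      rw [eq_sub_of_add_eq hw₀'.symm]
      exact sub_mem (Submodule.subset_span ⟨j, Function.update_self _ _ _⟩)
        (sum_mem fun l hl => Submodule.smul_mem _ _ (hother l (Finset.ne_of_mem_erase hl)))
    · exact hother j hj
  · rw [Function.update_self, hw₀, map_sum]
    have := hK i (Finset.mem_univ i)
    simpa [p, Polynomial.eval_finsetSum, mul_comm] using this

end Lattice

/-! ### Generators of subgroups of finite index in `H n` -/

section Generators

variable {n : ℕ}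

/-- A subgroup of finite index is generated, up to finitary permutations, by `n - 1` of its elements,
which can be chosen so that they generate all even finitary permutations. -/
theorem exists_generators (hn : 3 ≤ n) (U : Subgroup (H n)) [U.FiniteIndex] :
    ∃ u : Fin (n - 1) → H n, (∀ j, u j ∈ U) ∧
      FAlt (X n) ≤ (Subgroup.closure (Set.range u)).map (H n).subtype ∧
      ∀ x ∈ U, ∃ y ∈ Subgroup.closure (Set.range u), π n x = π n y := by
  have : Nonempty (Fin n) := ⟨⟨0, by omega⟩⟩
  have : Infinite (X n) := Prod.infinite_of_right
  have hA := FAlt_le_of_finiteIndex (FSym_le_H hn) U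
  let i₀ : Fin (n - 1) := ⟨0, by omega⟩
  let i₁ : Fin (n - 1) := ⟨1, by omega⟩
  have h01 : i₀ ≠ i₁ := by simp [i₀, i₁]
  let B := Module.finBasisOfFinrankEq ℤ (lattice U) (finrank_lattice U)
  let v : Fin (n - 1) → (Fin (n - 1) → ℤ) := fun j => B j
  have hv : Submodule.span ℤ (Set.range v) = lattice U := by
    have h1 : Set.range v = (lattice U).subtype '' Set.range B := by
      rw [← Set.range_comp]; rfl
    rw [h1, Submodule.span_image, B.span_eq, Submodule.map_top, Submodule.range_subtype]
  -- the functionals that record the translation lengths along the rays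
  let ℓ : Option (Fin (n - 1)) → (Fin (n - 1) → ℤ) →ₗ[ℤ] ℤ := fun o =>
    o.elim (∑ k, LinearMap.proj k) fun k => LinearMap.proj k
  obtain ⟨m, hm, hmU⟩ := exists_smul_single_mem_lattice U
  have hℓ : ∀ o, ∃ j, ℓ o (v j) ≠ 0 := by
    intro o
    by_contra! hc
    have h1 : lattice U ≤ LinearMap.ker (ℓ o) := by
      rw [← hv, Submodule.span_le]
      rintro _ ⟨j, rfl⟩
      exact hc j
    have h2 : ∀ k, ℓ o ((m : ℤ) • Pi.single k 1) = 0 := fun k => h1 (hmU k)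
    rcases o with _ | k
    · have := h2 i₀
      simp [ℓ, LinearMap.sum_apply, ← Finset.mul_sum] at this
      exact hm this
    · have := h2 k
      simp [ℓ] at this
      exact hm this
  obtain ⟨w, hw, hw₀⟩ := exists_span_eq_forall_ne_zero (i₀ := i₀) rfl ℓ v hℓ
  rw [hv] at hw
  have hlift : ∀ j, ∃ x ∈ U, π n x = Multiplicative.ofAdd (w j) := fun j => by
    rw [← mem_lattice, ← hw]
    exact Submodule.subset_span ⟨j, rfl⟩
  choose u huU hu using hlift
  have hne : ∀ i, transl (u i₀) i ≠ 0 := by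
    intro i
    rcases eq_ray₁_or_exists_ray i₀ i with rfl | ⟨k, rfl⟩
    · rw [transl_ray₁, hu]
      have := hw₀ none
      simpa [ℓ, LinearMap.sum_apply] using this
    · rw [transl_ray, hu]
      have := hw₀ (some k)
      simpa [ℓ] using this
  obtain ⟨hfin, R, hR⟩ := (transl_spec (u i₀)).finite_orbits hne
  have hcomm : (u i₀ * u i₁ * (u i₀)⁻¹ * (u i₁)⁻¹ : Perm (X n)) ∈ FSym (X n) := by
    have h1 : π n (u i₀ * u i₁ * (u i₀)⁻¹ * (u i₁)⁻¹) = 1 := by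
      rw [map_mul, map_mul, map_mul, map_inv, map_inv, mul_comm (π n (u i₀))]
      group
    exact (mem_FSym_iff hn).2 h1
  obtain ⟨β, hβ, hle⟩ := exists_FAlt_le_closure hfin hR hcomm
  obtain ⟨β', hβU, rfl⟩ := hA hβ
  have hβπ : π n β' = 1 := (mem_FSym_iff hn).1 (FAlt_le_FSym hβ)
  set u' := Function.update u i₁ (β' * u i₁) with hu'
  have hπ : ∀ j, π n (u' j) = Multiplicative.ofAdd (w j) := by
    intro j
    by_cases hj : j = i₁
    · subst hj
      rw [hu', Function.update_self, map_mul, hβπ, one_mul, hu]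
    · rw [hu', Function.update_of_ne hj, hu]
  refine ⟨u', fun j => ?_, hle.trans ?_, fun x hx => ?_⟩
  · by_cases hj : j = i₁
    · subst hj
      rw [hu', Function.update_self]
      exact mul_mem hβU (huU _)
    · rw [hu', Function.update_of_ne hj]
      exact huU j
  · rw [Subgroup.closure_le]
    rintro _ (rfl | rfl)
    · exact ⟨u i₀, Subgroup.subset_closure ⟨i₀, Function.update_of_ne h01 _ _⟩, rfl⟩
    · exact ⟨β' * u i₁, Subgroup.subset_closure ⟨i₁, Function.update_self _ _ _⟩, rfl⟩
  · have h1 : (π n x).toAdd ∈ lattice (Subgroup.closure (Set.range u')) := by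
      have h2 : (π n x).toAdd ∈ lattice U := ⟨x, hx, rfl⟩
      rw [lattice_closure_range]
      simpa only [hπ, toAdd_ofAdd, hw] using h2
    obtain ⟨y, hy, hxy⟩ := h1
    exact ⟨y, hy, hxy.symm⟩

/-- If `K ≤ U` maps onto the image of `U` under `π` and contains the finitary part of `U`, then
`K = U`. -/
theorem eq_of_le_of_finitary (hn : 3 ≤ n) {K U : Subgroup (H n)} (hKU : K ≤ U)
    (hπ : ∀ x ∈ U, ∃ y ∈ K, π n x = π n y)
    (hfin : ∀ x ∈ U, (x : Perm (X n)) ∈ FSym (X n) → x ∈ K) : K = U := by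
  refine le_antisymm hKU fun x hx => ?_
  obtain ⟨y, hy, hxy⟩ := hπ x hx
  have h1 : x * y⁻¹ ∈ K := by
    refine hfin _ (mul_mem hx (inv_mem (hKU hy))) ((mem_FSym_iff hn).2 ?_)
    rw [map_mul, map_inv, hxy, mul_inv_cancel]
  simpa using mul_mem h1 hy

theorem mem_of_mem_map_subtype {G : Type*} [Group G] {K : Subgroup G} {U : Subgroup K} {x : K}
    (h : (x : G) ∈ U.map K.subtype) : x ∈ U := by
  obtain ⟨y, hy, hyx⟩ := h
  rwa [← Subtype.ext hyx]

theorem rank_le_of_generators_eq {U : Subgroup (H n)} [Group.FG U] {u : Fin (n - 1) → H n}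
    (h : Subgroup.closure (Set.range u) = U) : Group.rank U ≤ n - 1 := by
  simpa using rank_le_of_closure_range_eq u h

theorem rank_le_add_one (hn : 3 ≤ n) (U : Subgroup (H n)) [U.FiniteIndex] :
    Group.rank U ≤ n - 1 + 1 := by
  obtain ⟨u, huU, hA, hπ⟩ := exists_generators hn U
  obtain ⟨b, hbU, hb⟩ : ∃ b ∈ U, ∀ x ∈ U, (x : Perm (X n)) ∈ FSym (X n) →
      ∀ K : Subgroup (H n), FAlt (X n) ≤ K.map (H n).subtype → b ∈ K → x ∈ K := by
    by_cases h : ∃ b ∈ U, (b : Perm (X n)) ∈ FSym (X n) ∧ (b : Perm (X n)) ∉ FAlt (X n)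
    · obtain ⟨b, h1, h2, h3⟩ := h
      refine ⟨b, h1, fun x _ hxF K hK hbK => mem_of_mem_map_subtype ?_⟩
      exact FSym_le_of_FAlt_le hK h2 h3 ⟨b, hbK, rfl⟩ hxF
    · push Not at h
      exact ⟨1, one_mem _, fun x hx hxF K hK _ => mem_of_mem_map_subtype (hK (h x hx hxF))⟩
  let u' : Option (Fin (n - 1)) → H n := fun o => o.elim b u
  have hmono : Subgroup.closure (Set.range u) ≤ Subgroup.closure (Set.range u') := by
    apply Subgroup.closure_mono
    rintro _ ⟨j, rfl⟩
    exact ⟨some j, rfl⟩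
  have h1 : Subgroup.closure (Set.range u') = U := by
    refine eq_of_le_of_finitary hn ?_ (fun x hx => ?_) fun x hx hxF => ?_
    · rw [Subgroup.closure_le]
      rintro _ ⟨_ | j, rfl⟩
      exacts [hbU, huU j]
    · obtain ⟨y, hy, hxy⟩ := hπ x hx
      exact ⟨y, hmono hy, hxy⟩
    · exact hb x hx hxF _ (hA.trans (Subgroup.map_mono hmono))
        (Subgroup.subset_closure ⟨none, rfl⟩)
  simpa using rank_le_of_closure_range_eq u' h1

theorem rank_le_of_not_FSym_le (hn : 3 ≤ n) (U : Subgroup (H n)) [U.FiniteIndex]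
    (h : ¬ FSym (X n) ≤ U.map (H n).subtype) : Group.rank U ≤ n - 1 := by
  obtain ⟨u, huU, hA, hπ⟩ := exists_generators hn U
  have hle : Subgroup.closure (Set.range u) ≤ U := by
    rw [Subgroup.closure_le]
    rintro _ ⟨j, rfl⟩
    exact huU j
  refine rank_le_of_generators_eq (eq_of_le_of_finitary hn hle hπ fun x hx hxF => ?_)
  refine mem_of_mem_map_subtype (hA ?_)
  by_contra hxA
  exact h (FSym_le_of_FAlt_le (hA.trans (Subgroup.map_mono hle)) hxF hxA ⟨x, hx, rfl⟩)

theorem exists_eq_mul_finitary (hn : 3 ≤ n) {x y : H n} (h : π n x = π n y) :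
    ∃ f ∈ FSym (X n), (x : Perm (X n)) = y * f := by
  refine ⟨(y⁻¹ * x : H n), (mem_FSym_iff hn).2 ?_, by simp⟩
  rw [map_mul, map_inv, h, inv_mul_cancel]

theorem commute_modFAlt_congr (hn : 3 ≤ n) {x x' y y' : H n} (hx : π n x = π n x')
    (hy : π n y = π n y') (h : Commute (modFAlt (x' : Perm (X n))) (modFAlt (y' : Perm (X n)))) :
    Commute (modFAlt (x : Perm (X n))) (modFAlt (y : Perm (X n))) := by
  have : Nontrivial (X n) := ⟨(⟨0, by omega⟩, 0), (⟨0, by omega⟩, 1), by simp⟩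
  obtain ⟨f, hf, hxf⟩ := exists_eq_mul_finitary hn hx
  obtain ⟨g, hg, hyg⟩ := exists_eq_mul_finitary hn hy
  rw [hxf, hyg, map_mul, map_mul]
  exact (h.mul_right (commute_modFAlt hg _).symm).mul_left
    ((commute_modFAlt hf _).mul_right (commute_modFAlt hf _))

/-- If `U` contains two elements whose commutator is odd, then `n - 1` elements generate `U`. -/
theorem rank_le_of_not_commute (hn : 3 ≤ n) (U : Subgroup (H n)) [U.FiniteIndex] {x y : H n}
    (hx : x ∈ U) (hy : y ∈ U)
    (h : ¬ Commute (modFAlt (x : Perm (X n))) (modFAlt (y : Perm (X n)))) :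
    Group.rank U ≤ n - 1 := by
  obtain ⟨u, huU, hA, hπ⟩ := exists_generators hn U
  have hle : Subgroup.closure (Set.range u) ≤ U := by
    rw [Subgroup.closure_le]
    rintro _ ⟨j, rfl⟩
    exact huU j
  refine rank_le_of_generators_eq (eq_of_le_of_finitary hn hle hπ fun f hf hfF => ?_)
  obtain ⟨x', hx', hxx'⟩ := hπ x hx
  obtain ⟨y', hy', hyy'⟩ := hπ y hy
  set c : H n := x' * y' * x'⁻¹ * y'⁻¹ with hc
  have hcF : (c : Perm (X n)) ∈ FSym (X n) := by
    refine (mem_FSym_iff hn).2 ?_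
    rw [hc, map_mul, map_mul, map_mul, map_inv, map_inv, mul_comm (π n x')]
    group
  have hcA : (c : Perm (X n)) ∉ FAlt (X n) := by
    intro hcA
    refine h (commute_modFAlt_congr hn hxx' hyy' ?_)
    rw [← modFAlt_eq_one, hc] at hcA
    simp only [Subgroup.coe_mul, Subgroup.coe_inv, map_mul, map_inv] at hcA
    exact mul_inv_eq_iff_eq_mul.1 (mul_inv_eq_one.1 hcA)
  have hcK : c ∈ Subgroup.closure (Set.range u) :=
    mul_mem (mul_mem (mul_mem hx' hy') (inv_mem hx')) (inv_mem hy')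
  exact mem_of_mem_map_subtype (FSym_le_of_FAlt_le hA hcF hcA ⟨c, hcK, rfl⟩ hfF)

end Generators

/-! ### Subgroups that are commutative modulo even permutations -/

section Commutative

variable {n : ℕ}

/-- Suppose that `n - 1` elements generate `U` and that `U` is commutative modulo `FAlt (X n)`. The
images of the generators under `π` are linearly independent, so every finitary element of `U` is
even. -/
theorem mem_FAlt_of_rank_eq (hn : 3 ≤ n) (U : Subgroup (H n)) [U.FiniteIndex]
    (hcomm : ∀ x ∈ U, ∀ y ∈ U, Commute (modFAlt (x : Perm (X n))) (modFAlt (y : Perm (X n))))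
    (hrank : Group.rank U = n - 1) {σ : H n} (hσ : σ ∈ U)
    (hσF : (σ : Perm (X n)) ∈ FSym (X n)) : (σ : Perm (X n)) ∈ FAlt (X n) := by
  obtain ⟨s, hs⟩ : ∃ s : Fin (n - 1) → H n, Subgroup.closure (Set.range s) = U := by
    rw [← hrank]; exact exists_closure_range_eq U
  let φ : H n →* Perm (X n) ⧸ FAlt (X n) := modFAlt.comp (H n).subtype
  let A : Subgroup (Perm (X n) ⧸ FAlt (X n)) := U.map φ
  let _ : CommGroup A :=
    { (inferInstance : Group A) with
      mul_comm := by
        rintro ⟨_, x, hx, rfl⟩ ⟨_, y, hy, rfl⟩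
        exact Subtype.ext (hcomm x hx y hy).eq }
  have hsU : ∀ j, s j ∈ U := fun j => by
    rw [← hs]; exact Subgroup.subset_closure ⟨j, rfl⟩
  let a : Fin (n - 1) → A := fun j => ⟨φ (s j), s j, hsU j, rfl⟩
  let v : Fin (n - 1) → (Fin (n - 1) → ℤ) := fun j => (π n (s j)).toAdd
  have key : ∀ x ∈ Subgroup.closure (Set.range s), ∃ k : Fin (n - 1) → ℤ,
      (π n x).toAdd = ∑ j, k j • v j ∧ φ x = ((∏ j, a j ^ k j : A) : Perm (X n) ⧸ FAlt (X n)) := by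
    intro x hx
    induction hx using Subgroup.closure_induction with
    | mem x hx =>
      obtain ⟨i, rfl⟩ := hx
      refine ⟨Pi.single i 1, ?_, ?_⟩
      · rw [Finset.sum_eq_single i]
        · simp [v]
        · intro j _ hj; simp [hj]
        · simp
      · rw [Finset.prod_eq_single i]
        · simp [a]
        · intro j _ hj; simp [hj]
        · simp
    | one => exact ⟨0, by simp, by simp⟩
    | mul x y _ _ hx hy =>
      obtain ⟨k, hk, hk'⟩ := hx
      obtain ⟨l, hl, hl'⟩ := hy
      refine ⟨k + l, ?_, ?_⟩
      · rw [map_mul, toAdd_mul, hk, hl]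
        simp only [Pi.add_apply, add_smul, Finset.sum_add_distrib]
      · rw [map_mul, hk', hl', ← Subgroup.coe_mul, ← Finset.prod_mul_distrib]
        simp only [Pi.add_apply, zpow_add]
    | inv x _ hx =>
      obtain ⟨k, hk, hk'⟩ := hx
      refine ⟨-k, ?_, ?_⟩
      · rw [map_inv, toAdd_inv, hk]
        simp only [Pi.neg_apply, neg_smul, Finset.sum_neg_distrib]
      · rw [map_inv, hk', ← Subgroup.coe_inv, ← Finset.prod_inv_distrib]
        simp only [Pi.neg_apply, zpow_neg]
  have hspan : Submodule.span ℤ (Set.range v) = lattice U := by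
    rw [← hs, lattice_closure_range]
  have hinj : Function.Injective (Fintype.linearCombination ℤ v) := by
    have hmem : ∀ k, Fintype.linearCombination ℤ v k ∈ lattice U := fun k => by
      rw [← hspan, ← Fintype.range_linearCombination]
      exact ⟨k, rfl⟩
    let f : (Fin (n - 1) → ℤ) →ₗ[ℤ] lattice U :=
      LinearMap.codRestrict (lattice U) (Fintype.linearCombination ℤ v) hmem
    have hf : Function.Surjective f := by
      rintro ⟨w, hw⟩
      rw [← hspan, ← Fintype.range_linearCombination] at hw
      obtain ⟨k, hk⟩ := hw
      exact ⟨k, Subtype.ext hk⟩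
    let e := (Module.finBasisOfFinrankEq ℤ (lattice U) (finrank_lattice U)).equivFun.symm
    have hfi := OrzechProperty.injective_of_surjective_of_injective e.toLinearMap f e.injective hf
    intro k l hkl
    exact hfi (Subtype.ext hkl)
  obtain ⟨k, hk, hk'⟩ := key σ (by rwa [hs])
  rw [(mem_FSym_iff hn).1 hσF, toAdd_one] at hk
  have hk0 : k = 0 := hinj (by
    rw [map_zero, Fintype.linearCombination_apply]; exact hk.symm)
  rw [hk0] at hk'
  exact modFAlt_eq_one.1 (hk'.trans (by simp))

theorem pow_mul_pow_eq {G : Type*} [Group G] {x y z : G} (h : x * y = z * (y * x))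
    (hzx : Commute z x) (hzy : Commute z y) (a b : ℕ) :
    x ^ a * y ^ b = z ^ (a * b) * (y ^ b * x ^ a) := by
  have h1 : ∀ b, x * y ^ b = z ^ b * (y ^ b * x) := by
    intro b
    induction b with
    | zero => simp
    | succ b ih =>
      calc x * y ^ (b + 1) = (x * y ^ b) * y := by rw [pow_succ, mul_assoc]
        _ = z ^ b * (y ^ b * (x * y)) := by rw [ih]; group
        _ = z ^ b * (y ^ b * z) * (y * x) := by rw [h]; group
        _ = z ^ b * (z * y ^ b) * (y * x) := by rw [(hzy.pow_right b).eq]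
        _ = z ^ (b + 1) * (y ^ (b + 1) * x) := by rw [pow_succ, pow_succ]; group
  induction a with
  | zero => simp
  | succ a ih =>
    calc x ^ (a + 1) * y ^ b = x ^ a * (x * y ^ b) := by rw [pow_succ, mul_assoc]
      _ = x ^ a * z ^ b * (y ^ b * x) := by rw [h1]; group
      _ = z ^ b * x ^ a * (y ^ b * x) := by rw [((hzx.pow_pow b a)).eq]
      _ = z ^ b * (x ^ a * y ^ b) * x := by group
      _ = z ^ b * (z ^ (a * b) * (y ^ b * x ^ a)) * x := by rw [ih]
      _ = z ^ ((a + 1) * b) * (y ^ b * x ^ (a + 1)) := by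
        rw [show (a + 1) * b = b + a * b by ring, pow_add, pow_succ]; group

/-- The commutator of `gen j ^ a` and `gen k ^ b` has the sign `(-1) ^ (a * b)`. -/
theorem commute_modFAlt_gen_pow_iff {j k : Fin (n - 1)} (hjk : j ≠ k) (a b : ℕ) :
    Commute (modFAlt (gen j ^ a)) (modFAlt (gen k ^ b)) ↔ Even (a * b) := by
  have hne : ((ray₁ k, 0) : X n) ≠ (ray₁ k, 1) := by simp
  have : Nontrivial (X n) := ⟨_, _, hne⟩
  set z := modFAlt (swap ((ray₁ k, 0) : X n) (ray₁ k, 1)) with hz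
  have hz1 : z ≠ 1 := fun h => swap_notMem_FAlt hne (modFAlt_eq_one.1 h)
  have hz2 : z * z = 1 := by rw [hz, ← map_mul, swap_mul_self, map_one]
  have h1 := congrArg modFAlt (gen_commutator hjk)
  rw [map_mul, map_mul, map_mul] at h1
  have h2 := pow_mul_pow_eq h1 (commute_modFAlt (swap_mem_FSym _ _) _)
    (commute_modFAlt (swap_mem_FSym _ _) _) a b
  rw [← hz] at h2
  rw [map_pow, map_pow, commute_iff_eq, h2, mul_eq_right]
  constructor
  · intro h3
    by_contra hodd
    rw [Nat.not_even_iff_odd] at hodd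
    obtain ⟨m, hm⟩ := hodd
    rw [hm, pow_succ, pow_mul, pow_two, hz2, one_pow, one_mul] at h3
    exact hz1 h3
  · rintro ⟨m, hm⟩
    rw [hm, ← two_mul, pow_mul, pow_two, hz2, one_pow]

/-- For a diagonal lattice, `n` generators are needed exactly if `U` contains all finitary
permutations and all commutators in `U` are even. -/
theorem rank_eq_iff_of_map_eq (hn : 3 ≤ n) (U : Subgroup (H n)) [U.FiniteIndex]
    (c : Fin (n - 1) → ℕ)
    (hU : U.map (π n) = Subgroup.closure
      (Set.range fun k => Multiplicative.ofAdd (Pi.single k (c k : ℤ)))) :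
    Group.rank U = n - 1 + 1 ↔ FSym (X n) ≤ U.map (H n).subtype ∧
      (Finset.univ.filter fun k => Odd (c k)).card ≤ 1 := by
  have hpow : ∀ k, π n (genH k ^ c k) = Multiplicative.ofAdd (Pi.single k (c k : ℤ)) := by
    intro k
    rw [map_pow, π_gen, ← ofAdd_nsmul]
    congr 1
    ext l
    by_cases hl : l = k
    · subst hl; simp
    · simp [hl]
  have hU' : U.map (π n) =
      (Subgroup.closure (Set.range fun k => genH k ^ c k : Set (H n))).map (π n) := by
    rw [hU, MonoidHom.map_closure, ← Set.range_comp]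
    congr 2
    funext k
    exact (hpow k).symm
  constructor
  · intro hrank
    refine ⟨?_, ?_⟩
    · by_contra h
      have := rank_le_of_not_FSym_le hn U h
      omega
    · by_contra! h
      obtain ⟨j, k, hj, hk, hjk⟩ := Finset.one_lt_card_iff.1 h
      simp only [Finset.mem_filter, Finset.mem_univ, true_and] at hj hk
      have hlift : ∀ k, ∃ x ∈ U, π n x = π n (genH k ^ c k) := fun k => by
        have h1 : π n (genH k ^ c k) ∈ U.map (π n) := by
          rw [hU']
          exact ⟨_, Subgroup.subset_closure ⟨k, rfl⟩, rfl⟩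
        exact h1
      obtain ⟨x, hx, hxj⟩ := hlift j
      obtain ⟨y, hy, hyk⟩ := hlift k
      have := rank_le_of_not_commute hn U hx hy fun hxy => by
        have h1 := commute_modFAlt_congr hn hxj.symm hyk.symm hxy
        have h2 := (commute_modFAlt_gen_pow_iff hjk (c j) (c k)).1 h1
        rw [Nat.even_mul, ← Nat.not_odd_iff_even, ← Nat.not_odd_iff_even] at h2
        tauto
      omega
  · rintro ⟨hF, hcard⟩
    have hgen : ∀ x ∈ Subgroup.closure (Set.range fun k => genH k ^ c k : Set (H n)),
        ∀ y ∈ Subgroup.closure (Set.range fun k => genH k ^ c k : Set (H n)),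
        Commute (modFAlt (x : Perm (X n))) (modFAlt (y : Perm (X n))) := by
      intro x hx y hy
      induction hx, hy using Subgroup.closure_induction₂ with
      | mem x y hx hy =>
        obtain ⟨j, rfl⟩ := hx
        obtain ⟨k, rfl⟩ := hy
        by_cases hjk : j = k
        · subst hjk; exact Commute.refl _
        · refine (commute_modFAlt_gen_pow_iff hjk (c j) (c k)).2 ?_
          by_contra hodd
          rw [Nat.not_even_iff_odd, Nat.odd_mul] at hodd
          exact absurd (Finset.one_lt_card_iff.2 ⟨j, k, Finset.mem_filter.2 ⟨Finset.mem_univ j, hodd.1⟩,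
            Finset.mem_filter.2 ⟨Finset.mem_univ k, hodd.2⟩, hjk⟩) (not_lt.2 hcard)
      | one_left => exact Commute.one_left _
      | one_right => exact Commute.one_right _
      | mul_left x y z _ _ _ h1 h2 => exact h1.mul_left h2
      | mul_right x y z _ _ _ h1 h2 => exact h1.mul_right h2
      | inv_left x y _ _ h => exact h.inv_left
      | inv_right x y _ _ h => exact h.inv_right
    have hlift : ∀ x ∈ U, ∃ y ∈ Subgroup.closure (Set.range fun k => genH k ^ c k : Set (H n)),
        π n x = π n y := fun x hx => by
      have h1 : π n x ∈ U.map (π n) := ⟨x, hx, rfl⟩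
      rw [hU'] at h1
      obtain ⟨y, hy, hyx⟩ := h1
      exact ⟨y, hy, hyx.symm⟩
    have hcomm : ∀ x ∈ U, ∀ y ∈ U,
        Commute (modFAlt (x : Perm (X n))) (modFAlt (y : Perm (X n))) := by
      intro x hx y hy
      obtain ⟨x', hx', hxx'⟩ := hlift x hx
      obtain ⟨y', hy', hyy'⟩ := hlift y hy
      exact commute_modFAlt_congr hn hxx' hyy' (hgen x' hx' y' hy')
    have hlow := le_rank U
    have hup := rank_le_add_one hn U
    have hne : Group.rank U ≠ n - 1 := by
      intro hrank
      have h01 : ((⟨0, by omega⟩, 0) : X n) ≠ (⟨0, by omega⟩, 1) := by simp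
      obtain ⟨τ, hτU, hτ⟩ := hF (swap_mem_FSym ((⟨0, by omega⟩, 0) : X n) (⟨0, by omega⟩, 1))
      have h1 := mem_FAlt_of_rank_eq hn U hcomm hrank hτU (by
        change (H n).subtype τ ∈ _
        rw [hτ]; exact swap_mem_FSym _ _)
      change (H n).subtype τ ∈ _ at h1
      rw [hτ] at h1
      exact swap_notMem_FAlt h01 h1
    omega

end Commutative

end Houghton


theorem theorem2 :
    (Group.rank Houghton.H₂ = 2 ∧
      ∀ U : Subgroup Houghton.H₂, ∀ [U.FiniteIndex], Group.rank U = Group.rank Houghton.H₂) ∧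
    ∀ n : ℕ, 3 ≤ n →
      Group.rank (Houghton.H n) = n - 1 ∧
      ∀ U : Subgroup (Houghton.H n), ∀ [U.FiniteIndex],
        (Group.rank U = Group.rank (Houghton.H n) ∨
          Group.rank U = Group.rank (Houghton.H n) + 1) ∧
        ∀ c : Fin (n - 1) → ℕ, (∀ k, 0 < c k) →
          U.map (Houghton.π n) = Subgroup.closure
            (Set.range fun k => Multiplicative.ofAdd (Pi.single k (c k : ℤ))) →
          (Group.rank U = Group.rank (Houghton.H n) + 1 ↔
            Houghton.FSym (Houghton.X n) ≤ U.map (Houghton.H n).subtype ∧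
            (Finset.univ.filter fun k => Odd (c k)).card ≤ 1) := by
  refine ⟨⟨Houghton.rank_H₂, fun U _ => ?_⟩, fun n hn => ⟨Houghton.rank_H n, fun U _ => ⟨?_, ?_⟩⟩⟩
  · rw [Houghton.rank_H₂, Houghton.rank_eq_two_of_finiteIndex U]
  · have h1 := Houghton.le_rank U
    have h2 := Houghton.rank_le_add_one hn U
    rw [Houghton.rank_H n]
    omega
  · intro c _ hU
    rw [Houghton.rank_H n]
    exact Houghton.rank_eq_iff_of_map_eq hn U c hU
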